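/- A homogeneous polynomial $h\in\mathbb{R}[x_1,\dots,x_n]$ is hyperbolic with respect to $\mathbf e\in\mathbb{R}^n$ if $h(\mathbf e)\neq 0$ and for every $\mathbf x\in\mathbb{R}^n$ the univariate polynomial $t\mapsto h(t\mathbf e-\mathbf x)$ has only real zeros. These zeros, counted with multiplicity, are the eigenvalues of $\mathbf x$. Let $\lambda_{\max}(\mathbf x)$ and $\lambda_{\min}(\mathbf x)$ be the largest and the smallest eigenvalue, let $\operatorname{tr}(\mathbf x)$ be the sum of the eigenvalues and $\operatorname{rk}(\mathbf x)$ the number of nonzero eigenvalues (both with multiplicity), and let $\Lambda_+=\{\mathbf x\in\mathbb{R}^n:\lambda_{\min}(\mathbf x)\ge 0\}$ be the closed hyperbolicity cone. Theorem. Suppose that $h$ is a nonconstant polynomial that is hyperbolic with respect to $\mathbf e\in\mathbb{R}^n$, and let $\epsilon\in\mathbb{R}$ and $m\geq 1$. Let $\mathsf X_1,\dots,\mathsf X_m$ be independent random vectors in $\mathbb{R}^n$ with finite supports such that, almost surely, $\mathsf X_i\in\Lambda_+$ and $\operatorname{rk}(\mathsf X_i)\le 1$ for every $i$. Suppose that $$\mathbb{E}\sum_{i=1}^m\mathsf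 X_i=\mathbf e\qquad\text{and}\qquad \operatorname{tr}(\mathbb{E}\,\mathsf X_i)\le\epsilon\quad\text{for all }1\le i\le m.$$ Then $$\mathbb{P}\left[\lambda_{\max}\left(\sum_{i=1}^m\mathsf X_i\right)\le\delta(\epsilon,m)\right]>0,\qquad\text{where}\quad \delta(\epsilon,m)=\left(1-\frac1m+\sqrt{\epsilon-\frac1m\left(1-\frac1m\right)}\right)^2.$$ (The hypotheses imply $\epsilon\ge 1/m$, so the number under the square root is at least $1/m^2$.) -/

import Mathlib

open MeasureTheory ProbabilityTheory

noncomputable section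

namespace HypPoly

variable {n : ℕ}

/-- The univariate polynomial `t ↦ h(t e - x)`. -/
def pencil (h : MvPolynomial (Fin n) ℝ) (e x : Fin n → ℝ) : Polynomial ℝ :=
  MvPolynomial.aeval (fun i => Polynomial.X * Polynomial.C (e i) - Polynomial.C (x i)) h

theorem eval_pencil (h : MvPolynomial (Fin n) ℝ) (e x : Fin n → ℝ) (t : ℝ) :
    (pencil h e x).eval t = MvPolynomial.eval (t • e - x) h := by
  have key : (Polynomial.aeval t).comp
      (MvPolynomial.aeval (fun i => Polynomial.X * Polynomial.C (e i) - Polynomial.C (x i)))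
      = MvPolynomial.aeval (R := ℝ) (t • e - x) := by
    ext i
    simp
    ring
  have := congrArg (fun φ => φ h) key
  simpa [pencil, Polynomial.coe_aeval_eq_eval, MvPolynomial.coe_aeval_eq_eval] using this

/-- A real polynomial `h` is hyperbolic with respect to `e ∈ ℝⁿ` if it is homogeneous, `h(e) ≠ 0`,
and for every `x ∈ ℝⁿ` the univariate polynomial `t ↦ h(t e - x)` has only real zeros, that is,
it factors over `ℝ` into polynomials of degree at most one. -/
structure IsHyperbolic (h : MvPolynomial (Fin n) ℝ) (e : Fin n → ℝ) : Prop where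
  homogeneous : ∃ d : ℕ, h.IsHomogeneous d
  eval_ne_zero : MvPolynomial.eval e h ≠ 0
  realRooted : ∀ x : Fin n → ℝ, (pencil h e x).Splits

/-- The eigenvalues `λ₁(x), …, λ_d(x)` of `x` with respect to `e`: the zeros of `t ↦ h(t e - x)`,
counted with multiplicity. -/
def eigenvalues (h : MvPolynomial (Fin n) ℝ) (e x : Fin n → ℝ) : Multiset ℝ :=
  (pencil h e x).roots

/-- The largest eigenvalue. (The set of eigenvalues is finite, and it is nonempty when `h` is
hyperbolic and not constant, so that this is a maximum.) -/
def lambdaMax (h : MvPolynomial (Fin n) ℝ) (e x : Fin n → ℝ) : ℝ :=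
  sSup {t : ℝ | t ∈ eigenvalues h e x}

/-- The smallest eigenvalue. -/
def lambdaMin (h : MvPolynomial (Fin n) ℝ) (e x : Fin n → ℝ) : ℝ :=
  sInf {t : ℝ | t ∈ eigenvalues h e x}

/-- The closed hyperbolicity cone `Λ₊(e)`. -/
def closedCone (h : MvPolynomial (Fin n) ℝ) (e : Fin n → ℝ) : Set (Fin n → ℝ) :=
  {x | 0 ≤ lambdaMin h e x}

/-- The trace: the sum of the eigenvalues, with multiplicity. -/
def trace (h : MvPolynomial (Fin n) ℝ) (e x : Fin n → ℝ) : ℝ :=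
  (eigenvalues h e x).sum

/-- The rank: the number of nonzero eigenvalues, with multiplicity. -/
def rank (h : MvPolynomial (Fin n) ℝ) (e x : Fin n → ℝ) : ℕ :=
  ((eigenvalues h e x).filter (fun t => t ≠ 0)).card

/-- `δ(ε, m) = (1 - 1/m + √(ε - (1/m)(1 - 1/m)))²`. -/
def delta (ε : ℝ) (m : ℕ) : ℝ :=
  (1 - 1 / (m : ℝ) + √(ε - 1 / (m : ℝ) * (1 - 1 / (m : ℝ)))) ^ 2

end HypPoly

end

/-!
The proof follows the method of interlacing families of Marcus, Spielman and Srivastava, in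
Brändén's version for hyperbolic polynomials. Normalize `h` so that `h e = 1`, let
`D_v` be the derivative in the direction `v`, and write `C` for the open hyperbolicity cone.

*From random vectors to their means.* If `w` has rank at most one, then `D_w² h = 0`
(`IsHyp.dirDeriv_dirDeriv_eq_zero`), so `h (x - ∑ w_i) = ∏ (1 - D_{w_i}) h (x)`
(`mixEval_sum_single`). The right-hand side is affine in each `w_i`, and its expectation for
independent `X_i` is `∏ (1 - D_{v_i}) h (x)` with `v_i = 𝔼 X_i`. Replacing the means by values of
positive probability one at a time, a point above the zeros of the mean polynomial can be kept
above the zeros (`MixAbove.exists_replace`).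

*One cone for everything.* For vectors `u_j` in the closed cone, the polynomial
`P (x, τ) = (∏_j (1 - τ_j D_{u_j}) h) (x)` in the joint variables `(x, τ)` is again homogeneous and
hyperbolic with respect to `(e, 0)` (`isHyp_mixPoly`): the logarithmic derivative of a stable
polynomial maps to the lower half-plane, so it is never the inverse of a number `τ_j` with
`Im τ_j ≤ 0`. By Gårding's theorem its hyperbolicity cone `K` is convex (`IsHyp.add_mem`), and
"`x` lies above the zeros of `∏_j (1 - τ_j D_{u_j}) h`" means `(x, τ) ∈ K`. All monotonicity and
convexity statements about barrier functions are instances of the convexity of `K`; raising one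
`τ_j` from zero stays in `K` as long as `P`, which is affine in `τ_j`, stays positive
(`MixAbove.add_single`).

*The bound.* It remains to place `(r² e, 1)` in `K` for the means `v_1, …, v_m`. If
`1/μ + 1/δ = 1`, moving `x` by `δ v_j` makes up for raising `τ_j` from `0` to `1`, while `(x, τ)`
stays in `K` with the value `μ` in any other unused slot (`MixAbove.barrier_step`). Starting from
a multiple of `e` and treating all indices except `i` leads to a point of `K` with `τ_i = μ` and
all other `τ_j = 1`. The sum of these points over `i` is a multiple of `(r² e, 1)` when
`μ = r / (r - 1)` and `δ = r`, provided that `r² / m + (1 - 1/m) (r - 1)² > ε`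
(`mixAbove_sq_smul`). The larger root `r` of the corresponding equation satisfies
`r² = δ(ε, m)`.
-/

noncomputable section
namespace HypPoly

/-! ### Directional derivatives and restrictions to lines -/

section Lines

variable {σ : Type*} {K : Type*} [Field K] [Algebra ℝ K]

/-- The derivative `D_v` of a polynomial in the direction `v`, as a derivation of the polynomial
ring. -/
def dirDeriv (v : σ → ℝ) :
    Derivation ℝ (MvPolynomial σ ℝ) (MvPolynomial σ ℝ) :=
  MvPolynomial.mkDerivation ℝ (fun i => MvPolynomial.C (v i))

@[simp] theorem dirDeriv_X (v : σ → ℝ) (i : σ) :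
    dirDeriv v (MvPolynomial.X i) = MvPolynomial.C (v i) :=
  MvPolynomial.mkDerivation_X _ _ _

@[simp] theorem dirDeriv_C (v : σ → ℝ) (a : ℝ) :
    dirDeriv v (MvPolynomial.C a) = 0 :=
  MvPolynomial.derivation_C _ _

theorem dirDeriv_comm (u v : σ → ℝ) (Q : MvPolynomial σ ℝ) :
    dirDeriv u (dirDeriv v Q) = dirDeriv v (dirDeriv u Q) := by
  have key : ⁅dirDeriv u, dirDeriv v⁆ = 0 :=
    MvPolynomial.derivation_ext fun i => by simp [Derivation.commutator_apply]
  have := congrArg (fun D => D Q) key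
  simpa [Derivation.commutator_apply, sub_eq_zero] using this

theorem derivation_sum_apply {κ : Type*} (s : Finset κ)
    (D : κ → Derivation ℝ (MvPolynomial σ ℝ) (MvPolynomial σ ℝ)) (Q : MvPolynomial σ ℝ) :
    (∑ k ∈ s, D k) Q = ∑ k ∈ s, D k Q := by
  classical
  induction s using Finset.induction_on with
  | empty => simp
  | insert k s hk ih => rw [Finset.sum_insert hk, Finset.sum_insert hk, Derivation.add_apply, ih]

theorem dirDeriv_eq_sum [Fintype σ] (v : σ → ℝ) (Q : MvPolynomial σ ℝ) :
    dirDeriv v Q = ∑ i, v i • MvPolynomial.pderiv i Q := by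
  classical
  have key : dirDeriv v = ∑ i, v i • MvPolynomial.pderiv i :=
    MvPolynomial.derivation_ext fun j => by
      rw [dirDeriv_X, derivation_sum_apply]
      simp [MvPolynomial.pderiv_X, Pi.single_apply, MvPolynomial.smul_eq_C_mul]
  rw [key, derivation_sum_apply]
  rfl

theorem dirDeriv_sum {κ : Type*} (s : Finset κ) (v : κ → σ → ℝ) (Q : MvPolynomial σ ℝ) :
    dirDeriv (∑ k ∈ s, v k) Q = ∑ k ∈ s, dirDeriv (v k) Q := by
  have key : dirDeriv (∑ k ∈ s, v k) = ∑ k ∈ s, dirDeriv (v k) :=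
    MvPolynomial.derivation_ext fun j => by
      rw [derivation_sum_apply]
      simp [Finset.sum_apply]
  rw [key, derivation_sum_apply]

theorem dirDeriv_smul (c : ℝ) (v : σ → ℝ) (Q : MvPolynomial σ ℝ) :
    dirDeriv (c • v) Q = c • dirDeriv v Q := by
  have key : dirDeriv (c • v) = c • dirDeriv v :=
    MvPolynomial.derivation_ext fun j => by
      simp [MvPolynomial.smul_eq_C_mul]
  rw [key]
  rfl

theorem isHomogeneous_dirDeriv [Fintype σ] (v : σ → ℝ) {Q : MvPolynomial σ ℝ} {d : ℕ}
    (hQ : Q.IsHomogeneous d) : (dirDeriv v Q).IsHomogeneous (d - 1) := by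
  rw [dirDeriv_eq_sum]
  refine MvPolynomial.IsHomogeneous.sum _ _ _ fun i _ => ?_
  rw [MvPolynomial.smul_eq_C_mul]
  exact (hQ.pderiv).C_mul _

theorem aeval_smul_of_isHomogeneous {Q : MvPolynomial σ ℝ} {d : ℕ} (hQ : Q.IsHomogeneous d)
    (c : K) (a : σ → K) :
    MvPolynomial.aeval (c • a) Q = c ^ d * MvPolynomial.aeval a Q := by
  rw [MvPolynomial.aeval_def, MvPolynomial.aeval_def, MvPolynomial.eval₂_eq,
    MvPolynomial.eval₂_eq, Finset.mul_sum]
  refine Finset.sum_congr rfl fun m hm => ?_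
  simp only [Pi.smul_apply, smul_eq_mul, mul_pow, Finset.prod_mul_distrib, Finset.prod_pow_eq_pow_sum]
  rw [← hQ.degree_eq_sum_deg_support hm]
  ring

/-- The restriction `t ↦ Q (a + t b)` of a real polynomial to a line, with base point and direction
in a field extension `K` of `ℝ`. -/
def linePoly (Q : MvPolynomial σ ℝ) (a b : σ → K) : Polynomial K :=
  MvPolynomial.aeval (fun i => Polynomial.C (a i) + Polynomial.X * Polynomial.C (b i)) Q

@[simp] theorem eval_linePoly (Q : MvPolynomial σ ℝ) (a b : σ → K) (t : K) :
    (linePoly Q a b).eval t = MvPolynomial.aeval (a + t • b) Q := by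
  have key : ((Polynomial.aeval t : Polynomial K →ₐ[K] K).restrictScalars ℝ).comp
      (MvPolynomial.aeval (fun i => Polynomial.C (a i) + Polynomial.X * Polynomial.C (b i)))
      = MvPolynomial.aeval (R := ℝ) (a + t • b) := by
    ext i
    simp [mul_comm (b i) t]
  have := congrArg (fun φ => φ Q) key
  simpa [linePoly, Polynomial.coe_aeval_eq_eval] using this

theorem derivative_linePoly (Q : MvPolynomial σ ℝ) (a : σ → K) (v : σ → ℝ) :
    Polynomial.derivative (linePoly Q a (fun i => algebraMap ℝ K (v i))) =
      linePoly (dirDeriv v Q) a (fun i => algebraMap ℝ K (v i)) := by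
  induction Q using MvPolynomial.induction_on with
  | C r => simp [linePoly, Polynomial.algebraMap_apply]
  | add p q hp hq => simp only [linePoly, map_add] at *; rw [hp, hq]
  | mul_X p i hp =>
    simp only [linePoly, map_mul, Derivation.leibniz, map_add, Polynomial.derivative_mul,
      MvPolynomial.aeval_X, smul_eq_mul, dirDeriv_X, MvPolynomial.aeval_C] at *
    rw [hp]
    simp [Polynomial.algebraMap_apply]
    ring

theorem natDegree_linePoly_le_and_coeff {Q : MvPolynomial σ ℝ} {d : ℕ} (hQ : Q.IsHomogeneous d)
    (a b : σ → K) :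
    (linePoly Q a b).natDegree ≤ d ∧ (linePoly Q a b).coeff d = MvPolynomial.aeval b Q := by
  set f : σ → Polynomial K := fun i => Polynomial.C (a i) + Polynomial.X * Polynomial.C (b i)
  have hf : ∀ i, (f i).natDegree ≤ 1 := fun i => by
    simp only [f]; compute_degree
  have hfc : ∀ i, (f i).coeff 1 = b i := fun i => by
    simp [f, Polynomial.coeff_C]
  have hprod : ∀ (s : Finset σ) (m : σ → ℕ),
      (∏ i ∈ s, f i ^ m i).natDegree ≤ ∑ i ∈ s, m i ∧
      (∏ i ∈ s, f i ^ m i).coeff (∑ i ∈ s, m i) = ∏ i ∈ s, b i ^ m i := by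
    classical
    intro s m
    induction s using Finset.induction_on with
    | empty => simp
    | insert i s hi ih =>
      have h1 : (f i ^ m i).natDegree ≤ m i := by
        simpa using Polynomial.natDegree_pow_le_of_le (m i) (hf i)
      have h2 : (f i ^ m i).coeff (m i) = b i ^ m i := by
        have := Polynomial.coeff_pow_of_natDegree_le (m := m i) (hf i)
        simpa [hfc] using this
      rw [Finset.prod_insert hi, Finset.sum_insert hi, Finset.prod_insert hi]
      exact ⟨Polynomial.natDegree_mul_le_of_le h1 ih.1, by
        rw [Polynomial.coeff_mul_add_eq_of_natDegree_le h1 ih.1, h2, ih.2]⟩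
  have hexp : linePoly Q a b = ∑ m ∈ Q.support,
      Polynomial.C (algebraMap ℝ K (Q.coeff m)) * ∏ i ∈ m.support, f i ^ m i := by
    rw [linePoly, MvPolynomial.aeval_def, MvPolynomial.eval₂_eq]
    rfl
  constructor
  · rw [hexp]
    refine Polynomial.natDegree_sum_le_of_forall_le _ _ fun m hm => ?_
    refine (Polynomial.natDegree_C_mul_le _ _).trans ?_
    rw [hQ.degree_eq_sum_deg_support hm]
    exact (hprod _ _).1
  · rw [hexp, Polynomial.finsetSum_coeff, MvPolynomial.aeval_def, MvPolynomial.eval₂_eq]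
    refine Finset.sum_congr rfl fun m hm => ?_
    rw [Polynomial.coeff_C_mul, hQ.degree_eq_sum_deg_support hm]
    rw [(hprod _ _).2]

theorem natDegree_linePoly {Q : MvPolynomial σ ℝ} {d : ℕ} (hQ : Q.IsHomogeneous d)
    (a : σ → K) {b : σ → K} (hb : MvPolynomial.aeval b Q ≠ 0) :
    (linePoly Q a b).natDegree = d := by
  obtain ⟨h1, h2⟩ := natDegree_linePoly_le_and_coeff hQ a b
  refine le_antisymm h1 (Polynomial.le_natDegree_of_ne_zero ?_)
  rwa [h2]

theorem leadingCoeff_linePoly {Q : MvPolynomial σ ℝ} {d : ℕ} (hQ : Q.IsHomogeneous d)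
    (a : σ → K) {b : σ → K} (hb : MvPolynomial.aeval b Q ≠ 0) :
    (linePoly Q a b).leadingCoeff = MvPolynomial.aeval b Q := by
  rw [Polynomial.leadingCoeff, natDegree_linePoly hQ a hb,
    (natDegree_linePoly_le_and_coeff hQ a b).2]

/-- Over `ℂ`, the restriction to a line of nondegenerate direction factors completely. -/
theorem aeval_add_smul_eq_prod_roots {Q : MvPolynomial σ ℝ} {d : ℕ} (hQ : Q.IsHomogeneous d)
    (a : σ → ℂ) {b : σ → ℂ} (hb : MvPolynomial.aeval b Q ≠ 0) (t : ℂ) :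
    MvPolynomial.aeval (a + t • b) Q =
      MvPolynomial.aeval b Q * ((linePoly Q a b).roots.map fun z => t - z).prod := by
  rw [← eval_linePoly, (IsAlgClosed.splits (linePoly Q a b)).eval_eq_prod_roots,
    leadingCoeff_linePoly hQ a hb]

theorem card_roots_linePoly {Q : MvPolynomial σ ℝ} {d : ℕ} (hQ : Q.IsHomogeneous d)
    (a : σ → ℂ) {b : σ → ℂ} (hb : MvPolynomial.aeval b Q ≠ 0) :
    (linePoly Q a b).roots.card = d := by
  rw [← (IsAlgClosed.splits (linePoly Q a b)).natDegree_eq_card_roots, natDegree_linePoly hQ a hb]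

/-- The complex vector with real and imaginary parts `x` and `y`. -/
def cvec (x y : σ → ℝ) : σ → ℂ := fun i => (x i : ℂ) + y i * Complex.I

/-- A real vector seen as a complex one. -/
def rvec (x : σ → ℝ) : σ → ℂ := fun i => (x i : ℂ)

theorem aeval_rvec (Q : MvPolynomial σ ℝ) (x : σ → ℝ) :
    MvPolynomial.aeval (rvec x) Q = ((MvPolynomial.eval x Q : ℝ) : ℂ) := by
  have := MvPolynomial.aeval_algebraMap_apply (A := ℝ) ℂ x Q
  simpa [show rvec x = Complex.ofReal ∘ x from rfl, MvPolynomial.coe_aeval_eq_eval] using this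

theorem eval_smul_of_isHomogeneous {Q : MvPolynomial σ ℝ} {d : ℕ} (hQ : Q.IsHomogeneous d)
    (c : ℝ) (a : σ → ℝ) :
    MvPolynomial.eval (c • a) Q = c ^ d * MvPolynomial.eval a Q := by
  simpa [MvPolynomial.coe_aeval_eq_eval] using aeval_smul_of_isHomogeneous hQ c a

theorem eval_linePoly_real (Q : MvPolynomial σ ℝ) (a b : σ → ℝ) (t : ℝ) :
    (linePoly Q a b).eval t = MvPolynomial.eval (a + t • b) Q := by
  simp

theorem hasDerivAt_eval_line (Q : MvPolynomial σ ℝ) (a v : σ → ℝ) (t : ℝ) :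
    HasDerivAt (fun t : ℝ => MvPolynomial.eval (a + t • v) Q)
      (MvPolynomial.eval (a + t • v) (dirDeriv v Q)) t := by
  have h := (linePoly Q a v).hasDerivAt t
  have h2 := derivative_linePoly (K := ℝ) Q a v
  simp only [Algebra.algebraMap_self, RingHom.id_apply] at h2
  simp only [h2, eval_linePoly_real] at h
  exact h

end Lines


/-! ### Hyperbolicity cones -/

section Cones

open Set Topology

variable {σ : Type*}

theorem continuous_aeval_complex (Q : MvPolynomial σ ℝ) :
    Continuous fun z : σ → ℂ => MvPolynomial.aeval z Q := by
  simp only [MvPolynomial.aeval_def, MvPolynomial.eval₂_eq]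
  fun_prop

theorem continuous_eval_real (Q : MvPolynomial σ ℝ) :
    Continuous fun z : σ → ℝ => MvPolynomial.eval z Q :=
  MvPolynomial.continuous_eval Q


/-- Zeros of a family of polynomials of constant degree do not enter an open set `U` without
crossing its boundary. -/
theorem zeroFree_of_path [Fintype σ] {Q : MvPolynomial σ ℝ} {d : ℕ} (hQ : Q.IsHomogeneous d)
    {U : Set ℂ} (hU : IsOpen U) (a₀ a₁ b : σ → ℂ) (hb : MvPolynomial.aeval b Q ≠ 0)
    (hbd : ∀ r ∈ Icc (0 : ℝ) 1, ∀ s ∈ closure U,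
      MvPolynomial.aeval (a₀ + (r : ℂ) • a₁ + s • b) Q = 0 → s ∈ U)
    (h0 : ∀ s ∈ U, MvPolynomial.aeval (a₀ + s • b) Q ≠ 0) :
    ∀ s ∈ U, MvPolynomial.aeval (a₀ + a₁ + s • b) Q ≠ 0 := by
  set F : ℝ × ℂ → ℂ := fun q => MvPolynomial.aeval (a₀ + (q.1 : ℂ) • a₁ + q.2 • b) Q with hF
  have hFc : Continuous F := (continuous_aeval_complex Q).comp (by fun_prop)
  set T : Set ℝ := {r | ∀ s ∈ U, F (r, s) ≠ 0} with hT
  -- a quantitative lower bound on `T` shows that `T` is closed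
  have hTclosed : IsClosed T := by
    have hlow : ∀ s ∈ U, ∃ κ > 0, ∀ r ∈ T, κ ≤ ‖F (r, s)‖ := by
      intro s hs
      obtain ⟨η, hη, hball⟩ := Metric.isOpen_iff.1 hU s hs
      refine ⟨‖MvPolynomial.aeval b Q‖ * η ^ d, by positivity, fun r hr => ?_⟩
      have hprod := aeval_add_smul_eq_prod_roots hQ (a₀ + (r : ℂ) • a₁) hb s
      have hne : linePoly Q (a₀ + (r : ℂ) • a₁) b ≠ 0 := by
        intro h
        have := leadingCoeff_linePoly hQ (a₀ + (r : ℂ) • a₁) hb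
        rw [h] at this
        exact hb (by simpa using this.symm)
      simp only [hF]
      rw [hprod, norm_mul]
      refine mul_le_mul_of_nonneg_left ?_ (norm_nonneg _)
      rw [← card_roots_linePoly hQ (a₀ + (r : ℂ) • a₁) hb]
      have : ∀ z ∈ (linePoly Q (a₀ + (r : ℂ) • a₁) b).roots, η ≤ ‖s - z‖ := by
        intro z hz
        by_contra hlt
        have hzU : z ∈ U := hball (by
          rw [Metric.mem_ball, dist_comm, dist_eq_norm]; exact not_le.1 hlt)
        refine hr z hzU ?_
        have := (Polynomial.mem_roots hne).1 hz
        rwa [Polynomial.IsRoot, eval_linePoly] at this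
      generalize (linePoly Q (a₀ + (r : ℂ) • a₁) b).roots = R at this
      induction R using Multiset.induction_on with
      | empty => simp
      | cons z R ih =>
        rw [Multiset.map_cons, Multiset.prod_cons, norm_mul, Multiset.card_cons, pow_succ']
        exact mul_le_mul (this z (Multiset.mem_cons_self z R))
          (ih fun w hw => this w (Multiset.mem_cons_of_mem hw)) (by positivity) (norm_nonneg _)
    refine isClosed_of_closure_subset fun r hr s hs => ?_
    obtain ⟨κ, hκ, hlow⟩ := hlow s hs
    have hcl : closure T ⊆ {r | κ ≤ ‖F (r, s)‖} :=
      closure_minimal (fun r hr => hlow r hr)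
        (isClosed_le continuous_const (by fun_prop))
    have := hcl hr
    intro h
    rw [mem_ofPred_eq, h, norm_zero] at this
    linarith
  -- zeros stay in a bounded set
  have hbdd : ∃ R : ℝ, ∀ r ∈ Icc (0 : ℝ) 1, ∀ s, F (r, s) = 0 → ‖s‖ ≤ R := by
    have hnhds : {z : σ → ℂ | MvPolynomial.aeval z Q ≠ 0} ∈ 𝓝 b :=
      (isOpen_ne_fun (continuous_aeval_complex Q) continuous_const).mem_nhds hb
    obtain ⟨η, hη, hball⟩ := Metric.mem_nhds_iff.1 hnhds
    refine ⟨(‖a₀‖ + ‖a₁‖) / η, fun r hr s hs => ?_⟩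
    by_contra hlt
    rw [not_le, div_lt_iff₀ hη] at hlt
    have hs0 : s ≠ 0 := by
      rintro rfl
      rw [norm_zero, zero_mul] at hlt
      have := norm_nonneg a₀
      have := norm_nonneg a₁
      linarith
    have hsn : 0 < ‖s‖ := norm_pos_iff.2 hs0
    have hmem : b + s⁻¹ • (a₀ + (r : ℂ) • a₁) ∈ Metric.ball b η := by
      rw [Metric.mem_ball, dist_eq_norm, add_sub_cancel_left, norm_smul, norm_inv,
        inv_mul_lt_iff₀ hsn]
      refine lt_of_le_of_lt ((norm_add_le _ _).trans ?_) hlt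
      rw [norm_smul]
      have : ‖(r : ℂ)‖ ≤ 1 := by
        rw [Complex.norm_real, Real.norm_eq_abs, abs_le]; constructor <;> linarith [hr.1, hr.2]
      have := mul_le_mul_of_nonneg_right this (norm_nonneg a₁)
      linarith
    refine hball hmem ?_
    have : F (r, s) = s ^ d * MvPolynomial.aeval (b + s⁻¹ • (a₀ + (r : ℂ) • a₁)) Q := by
      rw [← aeval_smul_of_isHomogeneous hQ, smul_add, smul_inv_smul₀ hs0, add_comm]
    rw [this] at hs
    exact (mul_eq_zero.1 hs).resolve_left (pow_ne_zero _ hs0)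
  obtain ⟨R, hR⟩ := hbdd
  have hZ : IsCompact ((Icc (0 : ℝ) 1 ×ˢ (Metric.closedBall (0 : ℂ) R ∩ closure U)) ∩ F ⁻¹' {0}) :=
    (isCompact_Icc.prod ((isCompact_closedBall _ _).inter_right isClosed_closure)).inter_right
      (isClosed_singleton.preimage hFc)
  have hproj := (hZ.image continuous_fst).isClosed
  have hsub : Icc (0 : ℝ) 1 ⊆ T := by
    refine IsClosed.Icc_subset_of_forall_mem_nhdsWithin (hTclosed.inter isClosed_Icc) ?_ ?_
    · intro s hs
      simpa [hF] using h0 s hs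
    · rintro r ⟨hrT, hr⟩
      have hnot : r ∉ Prod.fst '' ((Icc (0 : ℝ) 1 ×ˢ (Metric.closedBall (0 : ℂ) R ∩ closure U)) ∩
          F ⁻¹' {0}) := by
        rintro ⟨⟨r', s⟩, ⟨⟨hr', hs⟩, h⟩, rfl⟩
        exact hrT s (hbd _ hr' s hs.2 h) h
      have h1 : (_ : Set ℝ) ∈ 𝓝[>] r :=
        mem_nhdsWithin_of_mem_nhds (hproj.isOpen_compl.mem_nhds hnot)
      have h2 : Iio (1 : ℝ) ∈ 𝓝[>] r := mem_nhdsWithin_of_mem_nhds (Iio_mem_nhds hr.2)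
      filter_upwards [h1, h2, self_mem_nhdsWithin] with r' h1 h2 h3 s hs h
      have hr' : r' ∈ Icc (0 : ℝ) 1 := ⟨hr.1.trans (le_of_lt h3), le_of_lt h2⟩
      exact h1 ⟨(r', s), ⟨⟨hr', by simpa using hR r' hr' s h, subset_closure hs⟩, h⟩, rfl⟩
  intro s hs
  simpa [hF] using hsub (right_mem_Icc.2 zero_le_one) s hs


/-- `Q` is homogeneous of degree `d`, positive at `e`, and hyperbolic with respect to `e`; real
rootedness is phrased as the absence of zeros with imaginary part `e`. -/
structure IsHyp (Q : MvPolynomial σ ℝ) (d : ℕ) (e : σ → ℝ) : Prop where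
  homogeneous : Q.IsHomogeneous d
  pos : 0 < MvPolynomial.eval e Q
  ne_zero : ∀ x : σ → ℝ, MvPolynomial.aeval (cvec x e) Q ≠ 0

/-- The open hyperbolicity cone of `Q` with respect to `e`. -/
def openCone (Q : MvPolynomial σ ℝ) (e : σ → ℝ) : Set (σ → ℝ) :=
  {y | ∀ t : ℝ, 0 ≤ t → 0 < MvPolynomial.eval (y + t • e) Q}

/-- The closed hyperbolicity cone of `Q` with respect to `e`, as the set of points which enter the
open cone as soon as a positive multiple of `e` is added. -/
def closureCone (Q : MvPolynomial σ ℝ) (e : σ → ℝ) : Set (σ → ℝ) :=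
  {w | ∀ t : ℝ, 0 < t → w + t • e ∈ openCone Q e}

theorem pos_of_forall_ne_zero {f : ℝ → ℝ} (hf : Continuous f) (h0 : 0 < f 0)
    (hne : ∀ t, 0 < t → f t ≠ 0) {t : ℝ} (ht : 0 ≤ t) : 0 < f t := by
  by_contra hlt
  obtain ⟨s, hs, hs0⟩ := intermediate_value_Icc' ht hf.continuousOn
    (show (0 : ℝ) ∈ Icc (f t) (f 0) from ⟨not_lt.1 hlt, h0.le⟩)
  rcases hs.1.eq_or_lt with h | h
  · rw [← h] at hs0; exact h0.ne' hs0
  · exact hne s h hs0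

theorem continuous_eval_line (Q : MvPolynomial σ ℝ) (x v : σ → ℝ) :
    Continuous fun t : ℝ => MvPolynomial.eval (x + t • v) Q :=
  (continuous_eval_real Q).comp (by fun_prop)

/-- Restrictions to lines in a hyperbolic direction have only real zeros. -/
theorem im_eq_zero_of_root {Q : MvPolynomial σ ℝ} {d : ℕ} (hQ : Q.IsHomogeneous d) {y : σ → ℝ}
    (hy : ∀ x : σ → ℝ, MvPolynomial.aeval (cvec x y) Q ≠ 0) {x : σ → ℝ} {s : ℂ}
    (hs : MvPolynomial.aeval (rvec x + s • rvec y) Q = 0) : s.im = 0 := by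
  by_contra hne
  have hne' : (s.im : ℂ) ≠ 0 := by exact_mod_cast hne
  have : rvec x + s • rvec y = (s.im : ℂ) • cvec (s.im⁻¹ • (x + s.re • y)) y := by
    ext i
    simp only [rvec, cvec, Pi.add_apply, Pi.smul_apply, smul_eq_mul]
    push_cast
    field_simp
    nth_rewrite 1 [← Complex.re_add_im s]
    ring
  rw [this, aeval_smul_of_isHomogeneous hQ] at hs
  exact hy _ ((mul_eq_zero.1 hs).resolve_left (pow_ne_zero _ hne'))

theorem aeval_rvec_add_real_smul (Q : MvPolynomial σ ℝ) (x y : σ → ℝ) (t : ℝ) :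
    MvPolynomial.aeval (rvec x + (t : ℂ) • rvec y) Q =
      ((MvPolynomial.eval (x + t • y) Q : ℝ) : ℂ) := by
  rw [← aeval_rvec]
  congr 2
  ext i
  simp [rvec]

theorem closure_im_pos_subset : closure {s : ℂ | 0 < s.im} ⊆ {s | 0 ≤ s.im} :=
  closure_minimal (fun s hs => le_of_lt (show 0 < s.im from hs))
    (isClosed_le continuous_const Complex.continuous_im)

theorem closure_re_pos_subset : closure {s : ℂ | 0 < s.re} ⊆ {s | 0 ≤ s.re} :=
  closure_minimal (fun s hs => le_of_lt (show 0 < s.re from hs))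
    (isClosed_le continuous_const Complex.continuous_re)

theorem eval_pos_of_mem_openCone {Q : MvPolynomial σ ℝ} {e y : σ → ℝ} (hy : y ∈ openCone Q e) :
    0 < MvPolynomial.eval y Q := by
  simpa using hy 0 le_rfl

theorem add_smul_mem_openCone {Q : MvPolynomial σ ℝ} {e y : σ → ℝ} (hy : y ∈ openCone Q e)
    {t : ℝ} (ht : 0 ≤ t) : y + t • e ∈ openCone Q e := by
  intro s hs
  rw [add_assoc, ← add_smul]
  exact hy _ (by positivity)

theorem openCone_subset_closureCone {Q : MvPolynomial σ ℝ} {e y : σ → ℝ}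
    (hy : y ∈ openCone Q e) : y ∈ closureCone Q e :=
  fun _ ht => add_smul_mem_openCone hy ht.le

theorem mem_closureCone_iff {Q : MvPolynomial σ ℝ} {e w : σ → ℝ} :
    w ∈ closureCone Q e ↔ ∀ t : ℝ, 0 < t → 0 < MvPolynomial.eval (w + t • e) Q := by
  refine ⟨fun h t ht => eval_pos_of_mem_openCone (h t ht), fun h t ht s hs => ?_⟩
  rw [add_assoc, ← add_smul]
  exact h _ (by positivity)

/-- The open cone is open in the direction `-e`. -/
theorem exists_sub_smul_mem_openCone {Q : MvPolynomial σ ℝ} {e y : σ → ℝ}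
    (hy : y ∈ openCone Q e) : ∃ η : ℝ, 0 < η ∧ y - η • e ∈ openCone Q e := by
  have hc := continuous_eval_line Q y e
  have hnhds : {t : ℝ | 0 < MvPolynomial.eval (y + t • e) Q} ∈ 𝓝 0 :=
    (isOpen_lt continuous_const hc).mem_nhds (hy 0 le_rfl)
  obtain ⟨η, hη, hball⟩ := Metric.mem_nhds_iff.1 hnhds
  refine ⟨η / 2, by positivity, fun t ht => ?_⟩
  have heq : y - (η / 2) • e + t • e = y + (t - η / 2) • e := by
    rw [sub_smul]; abel
  rw [heq]
  rcases le_or_gt (η / 2) t with h | h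
  · exact hy _ (by linarith)
  · refine hball ?_
    rw [Metric.mem_ball, dist_zero_right, Real.norm_eq_abs, abs_lt]
    constructor <;> linarith

namespace IsHyp

variable {Q : MvPolynomial σ ℝ} {d : ℕ} {e : σ → ℝ}

theorem self_mem (hQ : IsHyp Q d e) : e ∈ openCone Q e := by
  intro t ht
  have : e + t • e = (1 + t) • e := by rw [add_smul, one_smul]
  rw [this, eval_smul_of_isHomogeneous hQ.homogeneous]
  have := hQ.pos
  positivity

theorem smul_mem (hQ : IsHyp Q d e) {y : σ → ℝ} (hy : y ∈ openCone Q e) {c : ℝ} (hc : 0 < c) :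
    c • y ∈ openCone Q e := by
  intro t ht
  have : c • y + t • e = c • (y + (t / c) • e) := by
    rw [smul_add, smul_smul, mul_div_cancel₀ _ hc.ne']
  rw [this, eval_smul_of_isHomogeneous hQ.homogeneous]
  have := hy (t / c) (by positivity)
  positivity

theorem smul_mem_closure (hQ : IsHyp Q d e) {w : σ → ℝ} (hw : w ∈ closureCone Q e) {c : ℝ}
    (hc : 0 ≤ c) : c • w ∈ closureCone Q e := by
  intro t ht
  rcases hc.eq_or_lt with rfl | hc
  · rw [zero_smul, zero_add]
    exact hQ.smul_mem hQ.self_mem ht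
  · have : c • w + t • e = c • (w + (t / c) • e) := by
      rw [smul_add, smul_smul, mul_div_cancel₀ _ hc.ne']
    rw [this]
    exact hQ.smul_mem (hw _ (by positivity)) hc

variable [Fintype σ]

/-- The component property of the open cone: a segment which starts in the cone and on which `Q`
is positive stays in the cone. -/
theorem add_mem_of_forall_pos (hQ : IsHyp Q d e) {y v : σ → ℝ} (hy : y ∈ openCone Q e)
    (hv : ∀ r ∈ Icc (0 : ℝ) 1, 0 < MvPolynomial.eval (y + r • v) Q) : y + v ∈ openCone Q e := by
  have hne : MvPolynomial.aeval (rvec e) Q ≠ 0 := by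
    rw [aeval_rvec]; exact_mod_cast hQ.pos.ne'
  have hcast : ∀ r : ℝ, rvec y + (r : ℂ) • rvec v = rvec (y + r • v) := fun r => by
    ext i; simp [rvec]
  have key := zeroFree_of_path hQ.homogeneous (U := {s : ℂ | 0 < s.re})
    (isOpen_lt continuous_const Complex.continuous_re) (rvec y) (rvec v) (rvec e) hne ?_ ?_
  · intro t ht
    have h1 := hv 1 (right_mem_Icc.2 zero_le_one)
    rw [one_smul] at h1
    refine pos_of_forall_ne_zero (continuous_eval_line Q (y + v) e) (by simpa using h1)
      (fun t ht h => ?_) ht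
    have := key t (by simpa using ht)
    rw [show rvec y + rvec v = rvec (y + v) by ext i; simp [rvec],
      aeval_rvec_add_real_smul, h] at this
    exact this (by simp)
  · intro r hr s hs h
    rw [hcast] at h
    have him := im_eq_zero_of_root hQ.homogeneous hQ.ne_zero h
    rcases (show 0 ≤ s.re from closure_re_pos_subset hs).eq_or_lt with h0 | h0
    · have hs0 : s = 0 := Complex.ext h0.symm him
      rw [hs0, zero_smul, add_zero, aeval_rvec] at h
      exact absurd (by exact_mod_cast h) (hv r hr).ne'
    · exact h0
  · intro s hs h
    have him := im_eq_zero_of_root hQ.homogeneous hQ.ne_zero h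
    have hs' : s = (s.re : ℂ) := Complex.ext (by simp) (by simpa using him)
    rw [hs', aeval_rvec_add_real_smul] at h
    exact absurd (by exact_mod_cast h) (hy s.re (le_of_lt hs)).ne'

/-- Gårding: a hyperbolic polynomial is hyperbolic in every direction of its open cone. -/
theorem aeval_cvec_ne_zero (hQ : IsHyp Q d e) {y : σ → ℝ} (hy : y ∈ openCone Q e) (x : σ → ℝ) :
    MvPolynomial.aeval (cvec x y) Q ≠ 0 := by
  have main : ∀ w ∈ openCone Q e, ∀ x, MvPolynomial.aeval (cvec x (e + w)) Q ≠ 0 := by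
    intro w hw x
    have hne : MvPolynomial.aeval (rvec w) Q ≠ 0 := by
      rw [aeval_rvec]; exact_mod_cast (eval_pos_of_mem_openCone hw).ne'
    have key := zeroFree_of_path hQ.homogeneous (U := {s : ℂ | 0 < s.im})
      (isOpen_lt continuous_const Complex.continuous_im) (Complex.I • rvec e) (rvec x) (rvec w)
      hne ?_ ?_
    · have := key Complex.I (by simp)
      convert this using 3
      ext i
      simp [cvec, rvec]
      ring
    · intro r hr s hs h
      rcases (show 0 ≤ s.im from closure_im_pos_subset hs).eq_or_lt with h0 | h0
      · have hs' : s = (s.re : ℂ) := Complex.ext (by simp) (by simpa using h0.symm)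
        rw [hs'] at h
        refine absurd ?_ (hQ.ne_zero (r • x + s.re • w))
        rw [← h]
        congr 2
        ext i
        simp [cvec, rvec]
        ring
      · exact h0
    · intro s hs h
      have hs0 : s ≠ 0 := by
        rintro rfl
        simp at hs
      have heq : Complex.I • rvec e + s • rvec w = s • (rvec w + (Complex.I / s) • rvec e) := by
        rw [smul_add, smul_smul, mul_div_cancel₀ _ hs0, add_comm]
      rw [heq, aeval_smul_of_isHomogeneous hQ.homogeneous] at h
      have h := (mul_eq_zero.1 h).resolve_left (pow_ne_zero _ hs0)
      have him := im_eq_zero_of_root hQ.homogeneous hQ.ne_zero h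
      set t : ℝ := (Complex.I / s).re with ht
      have ht' : Complex.I / s = (t : ℂ) := Complex.ext (by simp [ht]) (by simpa using him)
      rw [ht', aeval_rvec_add_real_smul] at h
      have hts : (t : ℂ) * s = Complex.I := by rw [← ht', div_mul_cancel₀ _ hs0]
      have him2 : t * s.im = 1 := by
        have := congrArg Complex.im hts
        simpa using this
      have htpos : 0 < t := by
        by_contra hneg
        have : t * s.im ≤ 0 := mul_nonpos_of_nonpos_of_nonneg (not_lt.1 hneg) (le_of_lt hs)
        linarith
      exact absurd (by exact_mod_cast h) (hw t htpos.le).ne'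
  obtain ⟨η, hη, hyη⟩ := exists_sub_smul_mem_openCone hy
  have hmem := hQ.smul_mem hyη (inv_pos.2 hη)
  have hne := main _ hmem (η⁻¹ • x)
  intro h
  have heq : cvec x y = (η : ℂ) • cvec (η⁻¹ • x) (e + η⁻¹ • (y - η • e)) := by
    have : (η : ℂ) ≠ 0 := by exact_mod_cast hη.ne'
    ext i
    simp [cvec]
    field_simp
    ring
  rw [heq, aeval_smul_of_isHomogeneous hQ.homogeneous] at h
  exact hne ((mul_eq_zero.1 h).resolve_left (pow_ne_zero _ (by exact_mod_cast hη.ne')))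

/-- Gårding: the open hyperbolicity cone is closed under addition. -/
theorem add_mem (hQ : IsHyp Q d e) {y₁ y₂ : σ → ℝ} (h₁ : y₁ ∈ openCone Q e)
    (h₂ : y₂ ∈ openCone Q e) : y₁ + y₂ ∈ openCone Q e := by
  have hne : MvPolynomial.aeval (rvec y₂) Q ≠ 0 := by
    rw [aeval_rvec]; exact_mod_cast (eval_pos_of_mem_openCone h₂).ne'
  have hcast : ∀ r : ℝ, rvec e + (r : ℂ) • rvec (y₁ - e) = rvec (e + r • (y₁ - e)) := fun r => by
    ext i; simp [rvec]
  have key := zeroFree_of_path hQ.homogeneous (U := {s : ℂ | 0 < s.re})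
    (isOpen_lt continuous_const Complex.continuous_re) (rvec e) (rvec (y₁ - e)) (rvec y₂) hne ?_ ?_
  · refine hQ.add_mem_of_forall_pos h₁ fun r hr => ?_
    refine pos_of_forall_ne_zero (continuous_eval_line Q y₁ y₂)
      (by simpa using eval_pos_of_mem_openCone h₁) (fun t ht h => ?_) hr.1
    have := key t (by simpa using ht)
    rw [show rvec e + rvec (y₁ - e) = rvec y₁ by ext i; simp [rvec],
      aeval_rvec_add_real_smul, h] at this
    exact this (by simp)
  · intro r hr s hs h
    rw [hcast] at h
    have him := im_eq_zero_of_root hQ.homogeneous (hQ.aeval_cvec_ne_zero h₂) h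
    rcases (show 0 ≤ s.re from closure_re_pos_subset hs).eq_or_lt with h0 | h0
    · have hs0 : s = 0 := Complex.ext h0.symm him
      rw [hs0, zero_smul, add_zero, aeval_rvec] at h
      refine absurd (by exact_mod_cast h) (ne_of_gt ?_)
      rcases hr.1.eq_or_lt with hr0 | hr0
      · simpa [← hr0] using hQ.pos
      · have heq : e + r • (y₁ - e) = r • (y₁ + ((1 - r) / r) • e) := by
          rw [smul_add, smul_smul, mul_div_cancel₀ _ hr0.ne', smul_sub, sub_smul, one_smul]
          abel
        rw [heq]
        have h1 := hr.2
        exact eval_pos_of_mem_openCone (hQ.smul_mem (add_smul_mem_openCone h₁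
          (div_nonneg (by linarith) hr0.le)) hr0)
    · exact h0
  · intro s hs h
    have him := im_eq_zero_of_root hQ.homogeneous (hQ.aeval_cvec_ne_zero h₂) h
    have hs' : s = (s.re : ℂ) := Complex.ext (by simp) (by simpa using him)
    have hre : 0 < s.re := hs
    rw [hs', aeval_rvec_add_real_smul] at h
    refine absurd (by exact_mod_cast h) (ne_of_gt ?_)
    have heq : e + s.re • y₂ = s.re • (y₂ + (s.re)⁻¹ • e) := by
      rw [smul_add, smul_inv_smul₀ hre.ne', add_comm]
    rw [heq]
    exact eval_pos_of_mem_openCone (hQ.smul_mem (add_smul_mem_openCone h₂ (by positivity)) hre)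

theorem add_closure_mem (hQ : IsHyp Q d e) {y w : σ → ℝ} (hy : y ∈ openCone Q e)
    (hw : w ∈ closureCone Q e) : y + w ∈ openCone Q e := by
  obtain ⟨η, hη, hyη⟩ := exists_sub_smul_mem_openCone hy
  have := hQ.add_mem hyη (hw η hη)
  rwa [show y - η • e + (w + η • e) = y + w by abel] at this

theorem add_mem_closure (hQ : IsHyp Q d e) {w₁ w₂ : σ → ℝ} (h₁ : w₁ ∈ closureCone Q e)
    (h₂ : w₂ ∈ closureCone Q e) : w₁ + w₂ ∈ closureCone Q e := by
  intro t ht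
  have := hQ.add_closure_mem (h₁ t ht) h₂
  rwa [show w₁ + t • e + w₂ = w₁ + w₂ + t • e by abel] at this

theorem sum_mem_closure (hQ : IsHyp Q d e) {κ : Type*} (s : Finset κ) {w : κ → σ → ℝ}
    (hw : ∀ k ∈ s, w k ∈ closureCone Q e) : ∑ k ∈ s, w k ∈ closureCone Q e := by
  classical
  induction s using Finset.induction_on with
  | empty =>
    intro t ht
    rw [Finset.sum_empty, zero_add]
    exact hQ.smul_mem hQ.self_mem ht
  | insert k s hk ih =>
    rw [Finset.sum_insert hk]
    exact hQ.add_mem_closure (hw k (Finset.mem_insert_self k s))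
      (ih fun j hj => hw j (Finset.mem_insert_of_mem hj))

theorem sum_mem (hQ : IsHyp Q d e) {κ : Type*} {s : Finset κ} (hs : s.Nonempty) {w : κ → σ → ℝ}
    (hw : ∀ k ∈ s, w k ∈ openCone Q e) : ∑ k ∈ s, w k ∈ openCone Q e := by
  classical
  obtain ⟨k, hk⟩ := hs
  rw [← Finset.add_sum_erase s w hk]
  exact hQ.add_closure_mem (hw k hk) (hQ.sum_mem_closure _ fun j hj =>
    openCone_subset_closureCone (hw j (Finset.mem_of_mem_erase hj)))

/-- Hyperbolic polynomials increase along the directions of their open cone. -/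
theorem eval_add_smul_mono (hQ : IsHyp Q d e) {x u : σ → ℝ} (hx : x ∈ openCone Q e)
    (hu : u ∈ openCone Q e) {s s' : ℝ} (hs : 0 ≤ s) (hss : s ≤ s') :
    MvPolynomial.eval (x + s • u) Q ≤ MvPolynomial.eval (x + s' • u) Q := by
  have hmem : ∀ t : ℝ, 0 ≤ t → x + t • u ∈ openCone Q e := fun t ht =>
    hQ.add_closure_mem hx (hQ.smul_mem_closure (openCone_subset_closureCone hu) ht)
  have hne : MvPolynomial.aeval (rvec u) Q ≠ 0 := by
    rw [aeval_rvec]; exact_mod_cast (eval_pos_of_mem_openCone hu).ne'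
  have hnorm : ∀ t : ℝ, 0 ≤ t → MvPolynomial.eval (x + t • u) Q =
      ‖MvPolynomial.aeval (rvec u) Q‖ *
        ((linePoly Q (rvec x) (rvec u)).roots.map fun z => ‖(t : ℂ) - z‖).prod := by
    intro t ht
    have h := aeval_add_smul_eq_prod_roots hQ.homogeneous (rvec x) hne (t : ℂ)
    have h := congrArg norm h
    rw [aeval_rvec_add_real_smul, norm_mul, Complex.norm_real, Real.norm_eq_abs,
      abs_of_pos (eval_pos_of_mem_openCone (hmem t ht))] at h
    rw [h]
    congr 1
    have := map_multiset_prod (normHom (α := ℂ))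
      ((linePoly Q (rvec x) (rvec u)).roots.map fun z => (t : ℂ) - z)
    simpa [Multiset.map_map] using this
  have hroot : ∀ z ∈ (linePoly Q (rvec x) (rvec u)).roots, z.im = 0 ∧ z.re < 0 := by
    intro z hz
    have h := Polynomial.isRoot_of_mem_roots hz
    rw [Polynomial.IsRoot, eval_linePoly] at h
    have him := im_eq_zero_of_root hQ.homogeneous (hQ.aeval_cvec_ne_zero hu) h
    refine ⟨him, ?_⟩
    by_contra hre
    have hz' : z = (z.re : ℂ) := Complex.ext (by simp) (by simpa using him)
    rw [hz', aeval_rvec_add_real_smul] at h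
    exact absurd (by exact_mod_cast h)
      (eval_pos_of_mem_openCone (hmem z.re (not_lt.1 hre))).ne'
  rw [hnorm s hs, hnorm s' (hs.trans hss)]
  refine mul_le_mul_of_nonneg_left ?_ (norm_nonneg _)
  generalize (linePoly Q (rvec x) (rvec u)).roots = R at hroot
  induction R using Multiset.induction_on with
  | empty => simp
  | cons z R ih =>
    rw [Multiset.map_cons, Multiset.prod_cons, Multiset.map_cons, Multiset.prod_cons]
    obtain ⟨him, hre⟩ := hroot z (Multiset.mem_cons_self z R)
    have hz' : z = (z.re : ℂ) := Complex.ext (by simp) (by simpa using him)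
    refine mul_le_mul ?_ (ih fun w hw => hroot w (Multiset.mem_cons_of_mem hw))
      (Multiset.prod_nonneg fun r hr => ?_) (norm_nonneg _)
    · rw [hz', ← Complex.ofReal_sub, ← Complex.ofReal_sub, Complex.norm_real, Complex.norm_real,
        Real.norm_eq_abs, Real.norm_eq_abs, abs_of_nonneg (by linarith),
        abs_of_nonneg (by linarith)]
      linarith
    · obtain ⟨w, _, rfl⟩ := Multiset.mem_map.1 hr
      exact norm_nonneg _

theorem eval_dirDeriv_nonneg (hQ : IsHyp Q d e) {x u : σ → ℝ} (hx : x ∈ openCone Q e)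
    (hu : u ∈ closureCone Q e) : 0 ≤ MvPolynomial.eval x (dirDeriv u Q) := by
  have main : ∀ u ∈ openCone Q e, 0 ≤ MvPolynomial.eval x (dirDeriv u Q) := by
    intro u hu
    have hd := hasDerivAt_eval_line Q x u 0
    rw [zero_smul, add_zero] at hd
    refine ge_of_tendsto hd.tendsto_slope_zero_right ?_
    filter_upwards [self_mem_nhdsWithin] with t ht
    have ht : 0 < t := ht
    have := hQ.eval_add_smul_mono hx hu le_rfl ht.le
    rw [smul_eq_mul]
    refine mul_nonneg (inv_nonneg.2 ht.le) ?_
    simpa using this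
  have hadd : ∀ t : ℝ, MvPolynomial.eval x (dirDeriv (u + t • e) Q) =
      MvPolynomial.eval x (dirDeriv u Q) + t * MvPolynomial.eval x (dirDeriv e Q) := by
    intro t
    have := dirDeriv_sum (Finset.univ : Finset (Fin 2)) ![u, t • e] Q
    simp only [Fin.sum_univ_two, Matrix.cons_val_zero, Matrix.cons_val_one] at this
    rw [this, map_add, dirDeriv_smul, MvPolynomial.smul_eval]
  have hlim : Filter.Tendsto (fun t : ℝ => MvPolynomial.eval x (dirDeriv u Q) +
      t * MvPolynomial.eval x (dirDeriv e Q)) (𝓝[>] 0) (𝓝 (MvPolynomial.eval x (dirDeriv u Q))) := by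
    refine Filter.Tendsto.mono_left ?_ nhdsWithin_le_nhds
    have : Continuous fun t : ℝ => MvPolynomial.eval x (dirDeriv u Q) +
      t * MvPolynomial.eval x (dirDeriv e Q) := by fun_prop
    simpa using this.tendsto 0
  refine ge_of_tendsto hlim ?_
  filter_upwards [self_mem_nhdsWithin] with t ht
  rw [← hadd]
  exact main _ (hu t ht)

end IsHyp

end Cones

/-! ### The mixed polynomial -/

section Mixed

open Set Topology

variable {α ι : Type*}

theorem dirDeriv_eq_zero_of_isHomogeneous_zero {σ : Type*} (v : σ → ℝ) {Q : MvPolynomial σ ℝ}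
    (hQ : Q.IsHomogeneous 0) : dirDeriv v Q = 0 := by
  have h : Q.totalDegree = 0 := Nat.le_zero.1 hQ.totalDegree_le
  rw [MvPolynomial.totalDegree_eq_zero_iff_eq_C.1 h, dirDeriv_C]

theorem eval_add_smul_of_dirDeriv_eq_zero {σ : Type*} {v : σ → ℝ} {Q : MvPolynomial σ ℝ}
    (hQ : dirDeriv v Q = 0) (x : σ → ℝ) (t : ℝ) :
    MvPolynomial.eval (x + t • v) Q = MvPolynomial.eval x Q := by
  have hd : ∀ t, HasDerivAt (fun t : ℝ => MvPolynomial.eval (x + t • v) Q) 0 t := fun t => by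
    simpa [hQ] using hasDerivAt_eval_line Q x v t
  have := is_const_of_deriv_eq_zero (fun t => (hd t).differentiableAt) (fun t => (hd t).deriv) t 0
  simpa using this

/-- The direction `v` in the space of the original variables, inside the space enlarged by one
variable for each element of `ι`. -/
abbrev baseDir (v : α → ℝ) : α ⊕ ι → ℝ := Sum.elim v 0

/-- The operator `1 - τ_j D_{u_j}`, where `τ_j` is the variable indexed by `j`. -/
def mixOp (u : ι → α → ℝ) (j : ι) (Q : MvPolynomial (α ⊕ ι) ℝ) : MvPolynomial (α ⊕ ι) ℝ :=
  Q - MvPolynomial.X (Sum.inr j) * dirDeriv (baseDir (u j)) Q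

theorem dirDeriv_baseDir_mixOp (u : ι → α → ℝ) (j : ι) (v : α → ℝ)
    (Q : MvPolynomial (α ⊕ ι) ℝ) :
    dirDeriv (baseDir v) (mixOp u j Q) = mixOp u j (dirDeriv (baseDir v) Q) := by
  simp only [mixOp, map_sub, Derivation.leibniz, dirDeriv_X, baseDir, Sum.elim_inr, Pi.zero_apply,
    MvPolynomial.C_0, smul_eq_mul, mul_zero, add_zero]
  rw [dirDeriv_comm]

instance mixOp_leftCommutative (u : ι → α → ℝ) : LeftCommutative (mixOp u) where
  left_comm j k Q := by
    conv_lhs => rw [mixOp, dirDeriv_baseDir_mixOp]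
    conv_rhs => rw [mixOp, dirDeriv_baseDir_mixOp]
    simp only [mixOp]
    rw [dirDeriv_comm (baseDir (u k))]
    ring

/-- The product of the operators `1 - τ_j D_{u_j}` over a multiset of indices, applied to `h`. -/
def mixFold (u : ι → α → ℝ) (h : MvPolynomial α ℝ) (s : Multiset ι) : MvPolynomial (α ⊕ ι) ℝ :=
  s.foldr (mixOp u) (MvPolynomial.rename Sum.inl h)

theorem mixFold_cons (u : ι → α → ℝ) (h : MvPolynomial α ℝ) (j : ι) (s : Multiset ι) :
    mixFold u h (j ::ₘ s) = mixOp u j (mixFold u h s) :=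
  Multiset.foldr_cons _ _ _ _

theorem dirDeriv_rename_inl (v : α → ℝ) (h : MvPolynomial α ℝ) :
    dirDeriv (baseDir (ι := ι) v) (MvPolynomial.rename Sum.inl h) =
      MvPolynomial.rename Sum.inl (dirDeriv v h) := by
  induction h using MvPolynomial.induction_on with
  | C r => simp
  | add p q hp hq => simp only [map_add, hp, hq]
  | mul_X p i hp =>
    simp only [map_mul, Derivation.leibniz, MvPolynomial.rename_X, dirDeriv_X, hp, map_add,
      smul_eq_mul, baseDir, Sum.elim_inl, MvPolynomial.rename_C]

theorem dirDeriv_mixFold (u : ι → α → ℝ) (h : MvPolynomial α ℝ) (v : α → ℝ) (s : Multiset ι) :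
    dirDeriv (baseDir v) (mixFold u h s) = mixFold u (dirDeriv v h) s := by
  induction s using Multiset.induction_on with
  | empty => simp [mixFold, dirDeriv_rename_inl]
  | cons j s ih => rw [mixFold_cons, mixFold_cons, dirDeriv_baseDir_mixOp, ih]

theorem isHomogeneous_mixFold [Fintype α] [Fintype ι] (u : ι → α → ℝ) {h : MvPolynomial α ℝ}
    {d : ℕ} (hh : h.IsHomogeneous d) (s : Multiset ι) : (mixFold u h s).IsHomogeneous d := by
  induction s using Multiset.induction_on with
  | empty => simpa [mixFold] using hh.rename_isHomogeneous
  | cons j s ih =>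
    rw [mixFold_cons, mixOp]
    rcases Nat.eq_zero_or_pos d with rfl | hd
    · simpa [dirDeriv_eq_zero_of_isHomogeneous_zero _ ih] using ih
    · refine ih.sub ?_
      have := (MvPolynomial.isHomogeneous_X ℝ (Sum.inr j : α ⊕ ι)).mul
        (isHomogeneous_dirDeriv (baseDir (u j)) ih)
      rwa [show 1 + (d - 1) = d by omega] at this

/-- Stability: `∏ (1 - τ_j D_{u_j}) h` has no zeros with `x` over the open hyperbolicity cone and
all `τ_j` in the closed lower half-plane. The logarithmic derivative in a direction of the closed
cone has negative imaginary part, so it cannot be the inverse of `τ_j`. -/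
theorem aeval_mixFold_ne_zero [Fintype α] {u : ι → α → ℝ} {h : MvPolynomial α ℝ} {d : ℕ}
    {e : α → ℝ} (hh : IsHyp h d e) (hu : ∀ j, u j ∈ closureCone h e) (s : Multiset ι)
    (Z : α ⊕ ι → ℂ) (hZ : (fun i => (Z (Sum.inl i)).im) ∈ openCone h e)
    (hZ' : ∀ j, (Z (Sum.inr j)).im ≤ 0) : MvPolynomial.aeval Z (mixFold u h s) ≠ 0 := by
  induction s using Multiset.induction_on generalizing Z with
  | empty =>
    have := hh.aeval_cvec_ne_zero hZ (fun i => (Z (Sum.inl i)).re)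
    rw [mixFold, Multiset.foldr_zero, MvPolynomial.aeval_rename]
    convert this using 3
    ext i
    simp [cvec]
  | cons j s ih =>
    rw [mixFold_cons]
    set Q := mixFold u h s
    set b : α ⊕ ι → ℂ := fun i => algebraMap ℝ ℂ (baseDir (u j) i) with hb
    have hline : ∀ t : ℂ, 0 ≤ t.im → (linePoly Q Z b).eval t ≠ 0 := by
      intro t ht
      rw [eval_linePoly]
      refine ih _ ?_ ?_
      · have := hh.add_closure_mem hZ (hh.smul_mem_closure (hu j) ht)
        convert this using 1
        ext i
        simp [hb]
      · intro k
        simpa [hb] using hZ' k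
    have hQ : MvPolynomial.aeval Z Q ≠ 0 := ih Z hZ hZ'
    have hp0 : (linePoly Q Z b).eval 0 = MvPolynomial.aeval Z Q := by simp
    have hder := (IsAlgClosed.splits (linePoly Q Z b)).eval_derivative_eq_eval_mul_sum
      (x := 0) (by rw [hp0]; exact hQ)
    rw [derivative_linePoly, hp0, eval_linePoly, zero_smul, add_zero] at hder
    have hroots : ∀ z ∈ (linePoly Q Z b).roots, z.im < 0 := by
      intro z hz
      by_contra hlt
      exact hline z (not_lt.1 hlt) (Polynomial.isRoot_of_mem_roots hz)
    set ξ := ((linePoly Q Z b).roots.map fun z => 1 / (0 - z)).sum with hξ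
    have hval : MvPolynomial.aeval Z (mixOp u j Q) =
        MvPolynomial.aeval Z Q * (1 - Z (Sum.inr j) * ξ) := by
      rw [mixOp, map_sub, map_mul, MvPolynomial.aeval_X, hder]
      ring
    rw [hval]
    refine mul_ne_zero hQ fun hzero => ?_
    have hone : Z (Sum.inr j) * ξ = 1 := (sub_eq_zero.1 hzero).symm
    have hξneg : ∀ R : Multiset ℂ, (∀ z ∈ R, z.im < 0) →
        R = 0 ∨ ((R.map fun z => 1 / (0 - z)).sum).im < 0 := by
      intro R hR
      induction R using Multiset.induction_on with
      | empty => exact Or.inl rfl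
      | cons z R ihR =>
        right
        have hz := hR z (Multiset.mem_cons_self z R)
        have hz0 : z ≠ 0 := by rintro rfl; simp at hz
        have h1 : (1 / (0 - z)).im < 0 := by
          rw [zero_sub, one_div, Complex.inv_im, Complex.neg_im, neg_neg, Complex.normSq_neg]
          exact div_neg_of_neg_of_pos hz (Complex.normSq_pos.2 hz0)
        rw [Multiset.map_cons, Multiset.sum_cons, Complex.add_im]
        rcases ihR (fun w hw => hR w (Multiset.mem_cons_of_mem hw)) with rfl | h2
        · simpa using h1
        · linarith
    rcases hξneg _ hroots with h0 | hneg
    · rw [hξ, h0] at hone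
      simp at hone
    · have hinv : ξ = (Z (Sum.inr j))⁻¹ := (inv_eq_of_mul_eq_one_right hone).symm
      rw [← hξ, hinv, Complex.inv_im] at hneg
      have : 0 ≤ -(Z (Sum.inr j)).im / Complex.normSq (Z (Sum.inr j)) :=
        div_nonneg (by linarith [hZ' j]) (Complex.normSq_nonneg _)
      linarith

variable [Fintype ι]

/-- The polynomial `(x, τ) ↦ (∏_j (1 - τ_j D_{u_j}) h) (x)`. -/
def mixPoly (u : ι → α → ℝ) (h : MvPolynomial α ℝ) : MvPolynomial (α ⊕ ι) ℝ :=
  mixFold u h Finset.univ.val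

theorem mixPoly_zero (u : ι → α → ℝ) : mixPoly u 0 = 0 := by
  rw [mixPoly]
  generalize (Finset.univ : Finset ι).val = s
  induction s using Multiset.induction_on with
  | empty => simp [mixFold]
  | cons j s ih => rw [mixFold_cons, ih, mixOp]; simp

theorem eval_mixPoly_zero (u : ι → α → ℝ) (h : MvPolynomial α ℝ) (x : α → ℝ) :
    MvPolynomial.eval (Sum.elim x 0) (mixPoly u h) = MvPolynomial.eval x h := by
  rw [mixPoly]
  generalize (Finset.univ : Finset ι).val = s
  induction s using Multiset.induction_on with
  | empty => simp [mixFold, MvPolynomial.eval_rename]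
  | cons j s ih => rw [mixFold_cons, mixOp]; simpa using ih

theorem dirDeriv_mixPoly (u : ι → α → ℝ) (h : MvPolynomial α ℝ) (v : α → ℝ) :
    dirDeriv (baseDir v) (mixPoly u h) = mixPoly u (dirDeriv v h) :=
  dirDeriv_mixFold u h v _

theorem hasDerivAt_eval_mixPoly (u : ι → α → ℝ) (h : MvPolynomial α ℝ) (x v : α → ℝ)
    (τ : ι → ℝ) (t : ℝ) :
    HasDerivAt (fun t : ℝ => MvPolynomial.eval (Sum.elim (x + t • v) τ) (mixPoly u h))
      (MvPolynomial.eval (Sum.elim (x + t • v) τ) (mixPoly u (dirDeriv v h))) t := by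
  have key : ∀ t : ℝ, (Sum.elim x τ : α ⊕ ι → ℝ) + t • baseDir v = Sum.elim (x + t • v) τ := by
    intro t; ext (i | i) <;> simp
  have := hasDerivAt_eval_line (mixPoly u h) (Sum.elim x τ) (baseDir v) t
  simpa only [key, dirDeriv_mixPoly] using this

/-- The mixed polynomial is affine in each of the variables `τ_j`. -/
theorem eval_mixPoly_add_single [DecidableEq ι] (u : ι → α → ℝ) (h : MvPolynomial α ℝ) (x : α → ℝ)
    {τ : ι → ℝ} {j : ι} (hj : τ j = 0) (T : ℝ) :
    MvPolynomial.eval (Sum.elim x (τ + T • Pi.single j 1)) (mixPoly u h) =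
      MvPolynomial.eval (Sum.elim x τ) (mixPoly u h) -
        T * MvPolynomial.eval (Sum.elim x τ) (mixPoly u (dirDeriv (u j) h)) := by
  set v : α ⊕ ι → ℝ := Sum.elim 0 (Pi.single j 1) with hv
  have hindep : ∀ (g : MvPolynomial α ℝ) (s : Multiset ι), j ∉ s →
      dirDeriv v (mixFold u g s) = 0 := by
    intro g s hs
    induction s using Multiset.induction_on with
    | empty =>
      rw [mixFold, Multiset.foldr_zero]
      induction g using MvPolynomial.induction_on with
      | C r => simp
      | add p q hp hq => simp only [map_add, hp, hq, add_zero]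
      | mul_X p i hp =>
        rw [map_mul, Derivation.leibniz, hp, MvPolynomial.rename_X, dirDeriv_X]
        simp [hv]
    | cons k s ih =>
      have hk : j ≠ k := fun h => hs (h ▸ Multiset.mem_cons_self k s)
      have hs' : j ∉ s := fun h => hs (Multiset.mem_cons_of_mem h)
      have hX : dirDeriv v (MvPolynomial.X (Sum.inr k)) = 0 := by
        rw [dirDeriv_X, hv, Sum.elim_inr, Pi.single_eq_of_ne hk.symm, MvPolynomial.C_0]
      rw [mixFold_cons, mixOp, map_sub, Derivation.leibniz, ih hs', dirDeriv_comm, ih hs', hX]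
      simp
  obtain ⟨s, hs⟩ := Multiset.exists_cons_of_mem (Finset.mem_univ_val j)
  have hjs : j ∉ s := by
    have := (Finset.univ : Finset ι).nodup
    rw [hs] at this
    exact (Multiset.nodup_cons.1 this).1
  have hpt : (Sum.elim x (τ + T • Pi.single j 1) : α ⊕ ι → ℝ) = Sum.elim x τ + T • v := by
    ext (i | i) <;> simp [hv]
  have hconst : ∀ g : MvPolynomial α ℝ,
      MvPolynomial.eval (Sum.elim x (τ + T • Pi.single j 1)) (mixFold u g s) =
        MvPolynomial.eval (Sum.elim x τ) (mixFold u g s) := fun g => by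
    rw [hpt]
    exact eval_add_smul_of_dirDeriv_eq_zero (hindep g s hjs) _ _
  simp only [mixPoly, hs, mixFold_cons, mixOp, map_sub, map_mul, MvPolynomial.eval_X,
    dirDeriv_mixFold, hconst, Sum.elim_inr, Pi.add_apply, hj, Pi.smul_apply, Pi.single_eq_same,
    smul_eq_mul, mul_one, zero_add, zero_mul, sub_zero]

/-- The mixed polynomial of vectors of the closed cone is hyperbolic. -/
theorem isHyp_mixPoly [Fintype α] {u : ι → α → ℝ} {h : MvPolynomial α ℝ} {d : ℕ}
    {e : α → ℝ} (hh : IsHyp h d e) (hu : ∀ j, u j ∈ closureCone h e) :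
    IsHyp (mixPoly u h) d (Sum.elim e 0) where
  homogeneous := isHomogeneous_mixFold u hh.homogeneous _
  pos := by rw [eval_mixPoly_zero]; exact hh.pos
  ne_zero x := by
    refine aeval_mixFold_ne_zero hh hu _ _ ?_ fun j => ?_
    · simpa [cvec] using hh.self_mem
    · simp [cvec]

end Mixed

/-! ### The barrier argument -/

section Barrier

open Set Topology

variable {α ι : Type*} [Fintype ι]

/-- The value of the mixed polynomial `∏_j (1 - τ_j D_{u_j}) h` at `x`. -/
def mixEval (u : ι → α → ℝ) (h : MvPolynomial α ℝ) (x : α → ℝ) (τ : ι → ℝ) : ℝ :=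
  MvPolynomial.eval (Sum.elim x τ) (mixPoly u h)

/-- The pair `(x, τ)` lies in the open hyperbolicity cone of the mixed polynomial, that is, `x` lies
above the zeros of `∏_j (1 - τ_j D_{u_j}) h`. -/
def MixAbove (u : ι → α → ℝ) (h : MvPolynomial α ℝ) (e x : α → ℝ) (τ : ι → ℝ) : Prop :=
  Sum.elim x τ ∈ openCone (mixPoly u h) (Sum.elim e 0)

theorem hasDerivAt_mixEval (u : ι → α → ℝ) (h : MvPolynomial α ℝ) (x v : α → ℝ)
    (τ : ι → ℝ) (t : ℝ) :
    HasDerivAt (fun t : ℝ => mixEval u h (x + t • v) τ)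
      (mixEval u (dirDeriv v h) (x + t • v) τ) t :=
  hasDerivAt_eval_mixPoly u h x v τ t

theorem mixEval_zero (u : ι → α → ℝ) (h : MvPolynomial α ℝ) (x : α → ℝ) :
    mixEval u h x 0 = MvPolynomial.eval x h :=
  eval_mixPoly_zero u h x

theorem mixEval_add_single [DecidableEq ι] (u : ι → α → ℝ) (h : MvPolynomial α ℝ) (x : α → ℝ)
    {τ : ι → ℝ} {j : ι} (hj : τ j = 0) (T : ℝ) :
    mixEval u h x (τ + T • Pi.single j 1) =
      mixEval u h x τ - T * mixEval u (dirDeriv (u j) h) x τ :=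
  eval_mixPoly_add_single u h x hj T

variable {u : ι → α → ℝ} {h : MvPolynomial α ℝ} {d : ℕ} {e x : α → ℝ} {τ : ι → ℝ}

theorem MixAbove.pos (hx : MixAbove u h e x τ) : 0 < mixEval u h x τ :=
  eval_pos_of_mem_openCone hx

theorem mixAbove_iff : MixAbove u h e x τ ↔ ∀ t : ℝ, 0 ≤ t → 0 < mixEval u h (x + t • e) τ := by
  have key : ∀ t : ℝ, (Sum.elim x τ : α ⊕ ι → ℝ) + t • Sum.elim e 0 = Sum.elim (x + t • e) τ := by
    intro t; ext (i | i) <;> simp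
  simp only [MixAbove, openCone, mem_ofPred_eq, key, mixEval]

variable [Fintype α]

theorem MixAbove.add (hh : IsHyp h d e) (hu : ∀ j, u j ∈ closureCone h e)
    (h₁ : MixAbove u h e x τ) {x' : α → ℝ} {τ' : ι → ℝ}
    (h₂ : MixAbove u h e x' τ') : MixAbove u h e (x + x') (τ + τ') := by
  have := (isHyp_mixPoly hh hu).add_mem h₁ h₂
  rw [MixAbove]
  convert this using 1
  ext (i | i) <;> simp

theorem MixAbove.smul (hh : IsHyp h d e) (hu : ∀ j, u j ∈ closureCone h e)
    (hx : MixAbove u h e x τ) {c : ℝ} (hc : 0 < c) : MixAbove u h e (c • x) (c • τ) := by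
  have := (isHyp_mixPoly hh hu).smul_mem hx hc
  rw [MixAbove]
  convert this using 1
  ext (i | i) <;> simp

theorem MixAbove.sum (hh : IsHyp h d e) (hu : ∀ j, u j ∈ closureCone h e) {κ : Type*}
    {s : Finset κ} (hs : s.Nonempty) {x : κ → α → ℝ} {τ : κ → ι → ℝ}
    (hx : ∀ k ∈ s, MixAbove u h e (x k) (τ k)) :
    MixAbove u h e (∑ k ∈ s, x k) (∑ k ∈ s, τ k) := by
  have := (isHyp_mixPoly hh hu).sum_mem hs hx
  rw [MixAbove]
  convert this using 1
  ext (i | i) <;> simp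

theorem MixAbove.add_base (hh : IsHyp h d e) (hu : ∀ j, u j ∈ closureCone h e)
    (hx : MixAbove u h e x τ) {w : α → ℝ} (hw : w ∈ closureCone h e) :
    MixAbove u h e (x + w) τ := by
  have hmem : baseDir (ι := ι) w ∈ closureCone (mixPoly u h) (Sum.elim e 0) := by
    rw [mem_closureCone_iff] at hw ⊢
    intro t ht
    have : baseDir (ι := ι) w + t • Sum.elim e 0 = Sum.elim (w + t • e) 0 := by
      ext (i | i) <;> simp
    rw [this, eval_mixPoly_zero]
    exact hw t ht
  have := (isHyp_mixPoly hh hu).add_closure_mem hx hmem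
  rw [MixAbove]
  convert this using 1
  ext (i | i) <;> simp

variable [DecidableEq ι]

theorem MixAbove.sub_single (hh : IsHyp h d e) (hu : ∀ j, u j ∈ closureCone h e)
    (hx : MixAbove u h e x τ) (j : ι) {T : ℝ} (hT : 0 ≤ T) :
    MixAbove u h e x (τ - T • Pi.single j 1) := by
  have hmem : (Sum.elim 0 (-Pi.single j 1) : α ⊕ ι → ℝ) ∈ closureCone (mixPoly u h) (Sum.elim e 0) := by
    rw [mem_closureCone_iff]
    intro t ht
    have : (Sum.elim 0 (-Pi.single j 1) : α ⊕ ι → ℝ) + t • Sum.elim e 0 =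
        Sum.elim (t • e) (0 + (-1 : ℝ) • Pi.single j 1) := by
      ext (i | i) <;> simp
    rw [this, eval_mixPoly_add_single u h (t • e) (τ := (0 : ι → ℝ)) (j := j) rfl, eval_mixPoly_zero, eval_mixPoly_zero]
    have hte := hh.smul_mem hh.self_mem ht
    have h1 := eval_pos_of_mem_openCone hte
    have h2 := hh.eval_dirDeriv_nonneg hte (hu j)
    linarith
  have hP := isHyp_mixPoly hh hu
  have := hP.add_closure_mem hx (hP.smul_mem_closure hmem hT)
  rw [MixAbove]
  convert this using 1
  ext (i | i) <;> simp [sub_eq_add_neg]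

/-- Raising a vanishing `τ_j` to `T` keeps a point above the zeros as long as the mixed polynomial
does not vanish. -/
theorem MixAbove.add_single (hh : IsHyp h d e) (hu : ∀ j, u j ∈ closureCone h e)
    (hx : MixAbove u h e x τ) {j : ι} (hj : τ j = 0) {T : ℝ}
    (hpos : 0 < mixEval u h x τ - T * mixEval u (dirDeriv (u j) h) x τ) :
    MixAbove u h e x (τ + T • Pi.single j 1) := by
  have hP := isHyp_mixPoly hh hu
  have := hP.add_mem_of_forall_pos (v := (Sum.elim 0 (T • Pi.single j 1) : α ⊕ ι → ℝ)) hx fun r hr => ?_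
  · rw [MixAbove]
    convert this using 1
    ext (i | i) <;> simp
  · have heq : (Sum.elim x τ : α ⊕ ι → ℝ) + r • (Sum.elim 0 (T • Pi.single j 1) : α ⊕ ι → ℝ) =
        Sum.elim x (τ + (r * T) • Pi.single j 1) := by
      ext (i | i) <;> simp [mul_assoc]
    rw [heq]
    change 0 < mixEval u h x _
    rw [mixEval_add_single _ _ _ hj]
    have h0 := hx.pos
    rcases hr.1.eq_or_lt with hr0 | hr0
    · rw [← hr0]; linarith
    · nlinarith [hr.2, mul_pos hr0 hpos]

theorem MixAbove.mixEval_dirDeriv_nonneg (hh : IsHyp h d e) (hu : ∀ j, u j ∈ closureCone h e)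
    (hx : MixAbove u h e x τ) {j : ι} (hj : τ j = 0) :
    0 ≤ mixEval u (dirDeriv (u j) h) x τ := by
  by_contra hlt
  rw [not_le] at hlt
  set p := mixEval u (dirDeriv (u j) h) x τ
  have h0 := hx.pos
  have := (hx.sub_single hh hu j (T := mixEval u h x τ / -p) (by
    exact div_nonneg h0.le (by linarith))).pos
  rw [sub_eq_add_neg, ← neg_smul, mixEval_add_single _ _ _ hj] at this
  change 0 < mixEval u h x τ - -(mixEval u h x τ / -p) * p at this
  have hp : p ≠ 0 := hlt.ne
  field_simp at this
  linarith

/-- Moving from `x` to `x + δ u_j` compensates for applying `1 - D_{u_j}`: the barrier in the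
direction `u_i`, which is the supremum of the admissible values of `τ_i`, does not drop below `γ`.
The reason is that this barrier is a concave function of the point, because the hyperbolicity cone
of the mixed polynomial is convex. -/
theorem MixAbove.barrier_step (hh : IsHyp h d e) (hu : ∀ j, u j ∈ closureCone h e)
    {i j : ι} (hij : i ≠ j) (hi : τ i = 0) (hj : τ j = 0) {γ μ δ : ℝ} (hγ : 0 ≤ γ) (hμ : 0 < μ)
    (hδ : 0 < δ) (hμδ : 1 / μ + 1 / δ = 1)
    (hxi : MixAbove u h e x (τ + γ • Pi.single i 1))
    (hxj : MixAbove u h e x (τ + μ • Pi.single j 1)) :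
    MixAbove u h e (x + δ • u j) (τ + γ • Pi.single i 1 + (1 : ℝ) • Pi.single j 1) := by
  have hmono : ∀ {τ' : ι → ℝ}, MixAbove u h e x τ' → ∀ t : ℝ, 0 ≤ t →
      MixAbove u h e (x + t • u j) τ' := fun hx t ht =>
    hx.add_base hh hu (hh.smul_mem_closure (hu j) ht)
  have hx : MixAbove u h e x τ := by
    simpa using hxi.sub_single hh hu i hγ
  set z := x + δ • u j with hz
  have hzi := hmono hxi δ hδ.le
  have hzj := hmono hxj δ hδ.le
  have hzτ := hmono hx δ hδ.le
  rw [← hz] at hzi hzj hzτ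
  set g := mixEval u h z τ with hg
  set p := mixEval u (dirDeriv (u j) h) z τ with hp
  set q := mixEval u (dirDeriv (u i) h) z τ with hq
  set s := mixEval u (dirDeriv (u j) (dirDeriv (u i) h)) z τ with hs
  have hgpos : 0 < g := hzτ.pos
  have hgq : 0 < g - γ * q := by
    have := hzi.pos
    rwa [mixEval_add_single _ _ _ hi] at this
  have hgp : 0 < g - μ * p := by
    have := hzj.pos
    rwa [mixEval_add_single _ _ _ hj] at this
  have hqn : 0 ≤ q := hzτ.mixEval_dirDeriv_nonneg hh hu hi
  have hG := fun t => hasDerivAt_mixEval u h x (u j) τ t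
  have hD := fun t => hasDerivAt_mixEval u (dirDeriv (u i) h) x (u j) τ t
  have hpg : p < g / μ := by rw [lt_div_iff₀ hμ]; linarith
  -- it suffices that `1 - D_{u_j}` leaves the polynomial with `τ_i = γ` positive at `z`
  refine hzi.add_single hh hu ?_ ?_
  · simp [hj, hij.symm]
  rw [mixEval_add_single _ _ _ hi, mixEval_add_single _ _ _ hi, dirDeriv_comm (u i)]
  change 0 < g - γ * q - 1 * (p - γ * s)
  rcases hqn.eq_or_lt with hq0 | hq0
  · -- the derivative in the direction `u_i` has an interior minimum at `z`
    have hmin : IsLocalMin (fun t : ℝ => mixEval u (dirDeriv (u i) h) (x + t • u j) τ) δ := by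
      filter_upwards [Ioi_mem_nhds hδ] with t ht
      change q ≤ _
      rw [← hq0]
      exact (hmono hx t (le_of_lt ht)).mixEval_dirDeriv_nonneg hh hu hi
    have hs0 : s = 0 := hmin.hasDerivAt_eq_zero (hD δ)
    have : g / μ < g := by
      have h1 : 0 < 1 / δ := by positivity
      have h2 : 1 / μ < 1 := by linarith
      have := mul_lt_mul_of_pos_left h2 hgpos
      rwa [mul_one_div, mul_one] at this
    rw [hs0, ← hq0]
    linarith
  · -- `γs` is the barrier at `z`; the chord from `(x, γ)` to `(z, γs)` lies in the cone
    set γs := g / q with hγs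
    have hγsq : γs * q = g := div_mul_cancel₀ _ hq0.ne'
    have hlt : γ < γs := by rw [hγs, lt_div_iff₀ hq0]; linarith
    have hγspos : 0 < γs := lt_of_le_of_lt hγ hlt
    set κ := (γs - γ) / δ with hκ
    have hκδ : κ * δ = γs - γ := div_mul_cancel₀ _ hδ.ne'
    set ψ : ℝ → ℝ := fun t => mixEval u h (x + t • u j) τ -
      (γ + t * κ) * mixEval u (dirDeriv (u i) h) (x + t • u j) τ with hψ
    have hψd : HasDerivAt ψ (p - (κ * q + γs * s)) δ := by
      have h1 : HasDerivAt (fun t : ℝ => γ + t * κ) κ δ := by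
        simpa using ((hasDerivAt_id δ).mul_const κ).const_add γ
      have h2 := (hG δ).sub (h1.mul (hD δ))
      have h3 : γ + δ * κ = γs := by linarith
      rw [h3] at h2
      exact h2
    have hψδ : ψ δ = 0 := by
      have h3 : γ + δ * κ = γs := by linarith
      simp only [hψ, h3]
      change g - γs * q = 0
      linarith
    have hchord : ∀ t ∈ Ioo (0 : ℝ) δ, 0 ≤ ψ t := by
      intro t ht
      have hpos : ∀ γ' ∈ Ioo γ γs, 0 < mixEval u h (x + t • u j) τ -
          (γ + t * ((γ' - γ) / δ)) * mixEval u (dirDeriv (u i) h) (x + t • u j) τ := by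
        intro γ' hγ'
        have hzγ : MixAbove u h e z (τ + γ' • Pi.single i 1) := by
          refine hzτ.add_single hh hu hi ?_
          change 0 < g - γ' * q
          have := mul_lt_mul_of_pos_right hγ'.2 hq0
          linarith
        have hθ : 0 < t / δ := div_pos ht.1 hδ
        have hθ' : 0 < 1 - t / δ := by rw [sub_pos, div_lt_one hδ]; exact ht.2
        have hcomb := ((hxi.smul hh hu hθ').add hh hu (hzγ.smul hh hu hθ)).pos
        have e1 : (1 - t / δ) • x + (t / δ) • z = x + t • u j := by
          rw [hz, smul_add, smul_smul, div_mul_cancel₀ _ hδ.ne', ← add_assoc, ← add_smul,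
            sub_add_cancel, one_smul]
        have e2 : (1 - t / δ) • (τ + γ • Pi.single i 1) + (t / δ) • (τ + γ' • Pi.single i 1) =
            τ + (γ + t * ((γ' - γ) / δ)) • (Pi.single i 1 : ι → ℝ) := by
          ext k
          simp only [Pi.add_apply, Pi.smul_apply, smul_eq_mul]
          ring
        rwa [e1, e2, mixEval_add_single _ _ _ hi] at hcomb
      have hcont : Filter.Tendsto (fun γ' => mixEval u h (x + t • u j) τ -
          (γ + t * ((γ' - γ) / δ)) * mixEval u (dirDeriv (u i) h) (x + t • u j) τ)
          (𝓝[<] γs) (𝓝 (ψ t)) := by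
        refine Filter.Tendsto.mono_left ?_ nhdsWithin_le_nhds
        refine Continuous.tendsto' (by fun_prop) _ _ ?_
        simp [hψ, hκ]
      refine ge_of_tendsto hcont ?_
      filter_upwards [Ioo_mem_nhdsLT hlt] with γ' hγ'
      exact (hpos γ' hγ').le
    have hψ' : p - (κ * q + γs * s) ≤ 0 := by
      have hslope := (hasDerivWithinAt_iff_tendsto_slope' (s := Iio δ) (by simp)).1
        hψd.hasDerivWithinAt
      refine le_of_tendsto hslope ?_
      filter_upwards [Ioo_mem_nhdsLT hδ] with t ht
      rw [slope_def_field, hψδ]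
      exact div_nonpos_of_nonneg_of_nonpos (by linarith [hchord t ht]) (by linarith [ht.2])
    -- with `θ = γ / γs`, the claim is the convex combination of `hψ'` and `p < g / μ`
    set θ := γ / γs with hθ
    have hθγ : θ * γs = γ := div_mul_cancel₀ _ hγspos.ne'
    have hθ0 : 0 ≤ θ := div_nonneg hγ hγspos.le
    have hθ1 : θ < 1 := by rw [hθ, div_lt_one hγspos]; exact hlt
    have hκq : κ * q = g * (1 - θ) / δ := by
      rw [eq_div_iff hδ.ne']
      have : γ * q = θ * g := by rw [← hγsq, ← hθγ]; ring
      linear_combination q * hκδ + hγsq - this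
    have hγq : γ * q = θ * g := by rw [← hγsq, ← hθγ]; ring
    have hγs' : γ * s = θ * (γs * s) := by rw [← hθγ]; ring
    have hsum : g / μ + g / δ = g := by
      have : g / μ + g / δ = g * (1 / μ + 1 / δ) := by ring
      rw [this, hμδ, mul_one]
    have h1 : θ * (p - κ * q) ≤ θ * (γs * s) := mul_le_mul_of_nonneg_left (by linarith) hθ0
    have hδg : 0 < g / δ := by positivity
    have h2 : p + θ * (g / δ) < g := by nlinarith
    have h3 := mul_pos (sub_pos.2 hθ1) (sub_pos.2 h2)
    have h4 : κ * q = (1 - θ) * (g / δ) := by rw [hκq]; ring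
    rw [hγq, hγs']
    rw [h4] at h1
    nlinarith

end Barrier

section Bound

open Set Topology

theorem mixEval_dirDeriv_sum {α ι : Type*} [Fintype ι] {u : ι → α → ℝ}
    {h : MvPolynomial α ℝ} (x : α → ℝ) (τ : ι → ℝ) (B : Finset ι) (p : ι → ℝ) :
    mixEval u (dirDeriv (∑ b ∈ B, p b • u b) h) x τ =
      ∑ b ∈ B, p b * mixEval u (dirDeriv (u b) h) x τ := by
  have hb : baseDir (ι := ι) (∑ b ∈ B, p b • u b) = ∑ b ∈ B, p b • baseDir (u b) := by
    ext (i | i) <;> simp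
  simp only [mixEval, ← dirDeriv_mixPoly]
  rw [hb, dirDeriv_sum, map_sum]
  refine Finset.sum_congr rfl fun b _ => ?_
  rw [dirDeriv_smul, MvPolynomial.smul_eval]

variable {α ι : Type*} [Fintype α] [Fintype ι] [DecidableEq ι]
variable {u : ι → α → ℝ} {h : MvPolynomial α ℝ} {d : ℕ} {e x : α → ℝ} {τ : ι → ℝ}

theorem sum_single_apply_of_notMem {ι : Type*} [DecidableEq ι] {S : Finset ι} {l : ι}
    (hl : l ∉ S) : (∑ j ∈ S, Pi.single j 1 : ι → ℝ) l = 0 := by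
  rw [Finset.sum_apply]
  refine Finset.sum_eq_zero fun i hi => Pi.single_eq_of_ne ?_ _
  rintro rfl
  exact hl hi

/-- Iterating `MixAbove.barrier_step` over a set `S` of indices. -/
theorem mixAbove_barrier_chain (hh : IsHyp h d e) (hu : ∀ j, u j ∈ closureCone h e)
    {A : Finset ι} {μ δ : ℝ} (hμ : 0 < μ) (hδ : 0 < δ) (hμδ : 1 / μ + 1 / δ = 1)
    (hx : ∀ k ∈ A, MixAbove u h e x (μ • Pi.single k 1)) (S : Finset ι) (hS : S ⊆ A) :
    ∀ k ∈ A, k ∉ S → MixAbove u h e (x + δ • ∑ j ∈ S, u j)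
      (∑ j ∈ S, Pi.single j 1 + μ • Pi.single k 1) := by
  induction S using Finset.induction_on with
  | empty =>
    intro k hk _
    simpa using hx k hk
  | insert j S hj ih =>
    intro k hk hkS
    rw [Finset.mem_insert, not_or] at hkS
    have hSA : S ⊆ A := fun l hl => hS (Finset.mem_insert_of_mem hl)
    have := MixAbove.barrier_step hh hu hkS.1 (sum_single_apply_of_notMem hkS.2)
      (sum_single_apply_of_notMem hj) hμ.le hμ hδ hμδ
      (ih hSA k hk hkS.2) (ih hSA j (hS (Finset.mem_insert_self j S)) hj)
    rw [Finset.sum_insert hj, Finset.sum_insert hj]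
    convert this using 1
    · rw [smul_add]; abel
    · rw [one_smul]; abel

/-- If the vectors `u_k`, `k ∈ A`, sum to `e` and have traces at most `ε`, then `r² e` lies above
the zeros of `∏_{k ∈ A} (1 - D_{u_k}) h` whenever `r²/M + (1 - 1/M) (r - 1)² > ε`, `M = |A|`.
The barrier argument with `μ = r / (r - 1)` and `δ = r` gives, for each choice of an index which is
treated last, a point of the hyperbolicity cone of the mixed polynomial in which this index has
weight `μ` and all others have weight one. The sum of these `M` points is a multiple of
`(r² e, 1)`. -/
theorem mixAbove_sq_smul (hh : IsHyp h d e) (hd : 0 < d) (hu : ∀ j, u j ∈ closureCone h e)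
    {A : Finset ι} (hA : A.Nonempty) (hsum : ∑ k ∈ A, u k = e) {ε r : ℝ}
    (htr : ∀ k ∈ A, MvPolynomial.eval e (dirDeriv (u k) h) ≤ ε * MvPolynomial.eval e h)
    (hr : 1 < r) (hε : ε < r ^ 2 / A.card + (1 - 1 / A.card) * (r - 1) ^ 2) :
    MixAbove u h e (r ^ 2 • e) (∑ k ∈ A, Pi.single k 1) := by
  set M : ℝ := (A.card : ℝ) with hM
  have hM1 : 1 ≤ M := by
    rw [hM]; exact_mod_cast hA.card_pos
  set ε' : ℝ := r ^ 2 / M + (1 - 1 / M) * (r - 1) ^ 2 with hε'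
  have hε'pos : 0 < ε' := by
    have h1 : 0 ≤ 1 - 1 / M := by
      rw [sub_nonneg, div_le_one (by linarith)]; exact hM1
    have h2 : 0 < r ^ 2 / M := by positivity
    have := mul_nonneg h1 (sq_nonneg (r - 1))
    linarith
  have hr1 : 0 < r - 1 := by linarith
  set μ : ℝ := r / (r - 1) with hμdef
  have hμ : 0 < μ := by positivity
  have hμr : μ * (r - 1) = r := div_mul_cancel₀ _ hr1.ne'
  have hμδ : 1 / μ + 1 / r = 1 := by
    rw [hμdef]; field_simp; ring
  have hstart : ∀ k ∈ A, MixAbove u h e ((μ * ε') • e) (μ • Pi.single k 1) := by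
    intro k hk
    have hpos : 0 < μ * ε' := by positivity
    have hmem := hh.smul_mem hh.self_mem hpos
    have h0 : MixAbove u h e ((μ * ε') • e) 0 := by
      rw [mixAbove_iff]
      intro t ht
      rw [mixEval_zero]
      exact hmem t ht
    have := h0.add_single hh hu (j := k) rfl (T := μ) ?_
    · simpa using this
    · rw [mixEval_zero, mixEval_zero, eval_smul_of_isHomogeneous hh.homogeneous,
        eval_smul_of_isHomogeneous (isHomogeneous_dirDeriv _ hh.homogeneous)]
      obtain ⟨d, rfl⟩ := Nat.exists_eq_succ_of_ne_zero hd.ne'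
      simp only [Nat.succ_eq_add_one, Nat.add_sub_cancel, pow_succ]
      have h1 := mul_lt_mul_of_pos_right hε hh.pos
      have h2 := mul_pos (pow_pos hpos d)
        (mul_pos hμ (sub_pos.2 (lt_of_le_of_lt (htr k hk) h1)))
      calc 0 < _ := h2
        _ = _ := by ring
  have hend : ∀ i ∈ A, MixAbove u h e ((μ * ε') • e + r • ∑ j ∈ A.erase i, u j)
      (∑ j ∈ A.erase i, Pi.single j 1 + μ • Pi.single i 1) := fun i hi =>
    mixAbove_barrier_chain hh hu hμ (by linarith) hμδ hstart (A.erase i) (A.erase_subset i) i hi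
      (Finset.notMem_erase i A)
  have htot := MixAbove.sum hh hu hA hend
  have hw : 0 < M - 1 + μ := by linarith
  have hfin := htot.smul hh hu (inv_pos.2 hw)
  have e1 : ∑ i ∈ A, ((μ * ε') • e + r • ∑ j ∈ A.erase i, u j) = ((M - 1 + μ) * r ^ 2) • e := by
    have : ∀ i ∈ A, (μ * ε') • e + r • ∑ j ∈ A.erase i, u j = (μ * ε' + r) • e - r • u i := by
      intro i hi
      rw [Finset.sum_erase_eq_sub hi, hsum, smul_sub, add_smul]
      abel
    rw [Finset.sum_congr rfl this, Finset.sum_sub_distrib, Finset.sum_const, ← Finset.smul_sum,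
      hsum, ← Nat.cast_smul_eq_nsmul ℝ, smul_smul, ← sub_smul, ← hM]
    congr 1
    have hMε : M * ε' = r ^ 2 + (M - 1) * (r - 1) ^ 2 := by
      rw [hε']; field_simp
    linear_combination μ * hMε + (M - 1) * (r - 1) * hμr
  have e2 : ∑ i ∈ A, (∑ j ∈ A.erase i, Pi.single j 1 + μ • Pi.single i 1 : ι → ℝ) =
      (M - 1 + μ) • ∑ k ∈ A, Pi.single k 1 := by
    have : ∀ i ∈ A, (∑ j ∈ A.erase i, Pi.single j 1 + μ • Pi.single i 1 : ι → ℝ) =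
        ∑ j ∈ A, Pi.single j 1 + (μ - 1) • Pi.single i 1 := by
      intro i hi
      rw [Finset.sum_erase_eq_sub hi, sub_smul, one_smul]
      abel
    rw [Finset.sum_congr rfl this, Finset.sum_add_distrib, Finset.sum_const, ← Finset.smul_sum,
      ← Nat.cast_smul_eq_nsmul ℝ, ← add_smul, ← hM]
    congr 1
    ring
  rwa [e1, e2, smul_smul, smul_smul, ← mul_assoc, inv_mul_cancel₀ hw.ne', one_mul, one_smul]
    at hfin

/-! ### Selecting values of the random vectors -/

/-- A convex combination of vectors can be replaced by one of them. -/
theorem MixAbove.exists_replace (hh : IsHyp h d e) (hu : ∀ j, u j ∈ closureCone h e)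
    {a : ι} (ha : τ a = 0) {B : Finset ι} (hB : ∀ b ∈ B, τ b = 0) {p : ι → ℝ}
    (hp : ∀ b ∈ B, 0 ≤ p b) (hp1 : ∑ b ∈ B, p b = 1) (hmean : u a = ∑ b ∈ B, p b • u b)
    (hx : MixAbove u h e x (τ + Pi.single a 1)) :
    ∃ b ∈ B, 0 < p b ∧ MixAbove u h e x (τ + Pi.single b 1) := by
  have h0 : MixAbove u h e x τ := by
    simpa using hx.sub_single hh hu a zero_le_one
  have hpos := hx.pos
  rw [← one_smul ℝ (Pi.single a 1 : ι → ℝ), mixEval_add_single _ _ _ ha, hmean,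
    mixEval_dirDeriv_sum, one_mul] at hpos
  have hsum : 0 < ∑ b ∈ B, p b * (mixEval u h x τ - mixEval u (dirDeriv (u b) h) x τ) := by
    simp only [mul_sub, Finset.sum_sub_distrib, ← Finset.sum_mul, hp1, one_mul]
    exact hpos
  obtain ⟨b, hbB, hb⟩ : ∃ b ∈ B,
      0 < p b * (mixEval u h x τ - mixEval u (dirDeriv (u b) h) x τ) := by
    by_contra! hcon
    exact absurd hsum (not_lt.2 (Finset.sum_nonpos hcon))
  have hpb : 0 < p b := (hp b hbB).lt_of_ne fun h => by simp [← h] at hb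
  refine ⟨b, hbB, hpb, ?_⟩
  have := h0.add_single hh hu (hB b hbB) (T := 1)
    (by rw [one_mul]; exact pos_of_mul_pos_right hb hpb.le)
  rwa [one_smul] at this

end Bound

/-! ### Vectors of rank one -/

section RankOne

open Set Topology

variable {α : Type*} {h : MvPolynomial α ℝ} {d : ℕ} {e : α → ℝ}

theorem natDegree_le_one_of_abs_le {p : Polynomial ℝ} {a b : ℝ}
    (hp : ∀ s : ℝ, 0 ≤ s → |p.eval s| ≤ a + b * s) : p.natDegree ≤ 1 := by
  by_contra hlt
  have hdeg : (Polynomial.X : Polynomial ℝ).degree < p.degree := by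
    refine Polynomial.degree_lt_degree ?_
    rw [Polynomial.natDegree_X]
    exact not_le.1 hlt
  have hO : p.eval =O[Filter.atTop] (Polynomial.X : Polynomial ℝ).eval := by
    refine Asymptotics.IsBigO.of_bound (|a| + |b|) ?_
    filter_upwards [Filter.eventually_ge_atTop 1] with s hs
    rw [Real.norm_eq_abs, Polynomial.eval_X, Real.norm_eq_abs, abs_of_nonneg (by linarith : 0 ≤ s)]
    refine (hp s (by linarith)).trans ?_
    have h1 : a ≤ |a| * s := (le_abs_self a).trans (le_mul_of_one_le_right (abs_nonneg a) hs)
    have h2 : b * s ≤ |b| * s := mul_le_mul_of_nonneg_right (le_abs_self b) (by linarith)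
    linarith
  have ho := (Polynomial.isLittleO_atTop_of_degree_lt _ _ hdeg).trans_isBigO hO
  obtain ⟨s, hs, hs1⟩ := ((ho.def (c := 1 / 2) (by norm_num)).and
    (Filter.eventually_ge_atTop 1)).exists
  rw [Polynomial.eval_X, Real.norm_eq_abs, abs_of_nonneg (by linarith : 0 ≤ s)] at hs
  linarith

theorem IsHyp.exists_add_smul_mem (hh : IsHyp h d e) (y : α → ℝ) :
    ∃ η₀ : ℝ, 0 < η₀ ∧ ∀ η : ℝ, |η| < η₀ → e + η • y ∈ openCone h e := by
  have hc := continuous_eval_line h e y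
  have hnhds : {t : ℝ | 0 < MvPolynomial.eval (e + t • y) h} ∈ 𝓝 0 :=
    (isOpen_lt continuous_const hc).mem_nhds (by simpa using hh.pos)
  obtain ⟨η₀, hη₀, hball⟩ := Metric.mem_nhds_iff.1 hnhds
  refine ⟨η₀, hη₀, fun η hη t ht => ?_⟩
  have ht1 : 0 < 1 + t := by linarith
  have heq : e + η • y + t • e = (1 + t) • (e + (η / (1 + t)) • y) := by
    rw [smul_add, smul_smul, mul_div_cancel₀ _ ht1.ne', add_smul, one_smul]
    abel
  rw [heq, eval_smul_of_isHomogeneous hh.homogeneous]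
  refine mul_pos (pow_pos ht1 d) (hball ?_)
  rw [Metric.mem_ball, dist_zero_right, Real.norm_eq_abs, abs_div, abs_of_pos ht1]
  exact lt_of_le_of_lt (div_le_self (abs_nonneg _) (by linarith)) hη

/-- If `h` has degree at most one along the line through `e` in a direction `w` of the closed cone,
then it has degree at most one along every line in the direction `w`: at points `x` near `e` the
restriction is dominated by that at `2 e`, as `2 e - x` lies in the cone. -/
theorem IsHyp.dirDeriv_dirDeriv_eq_zero [Fintype α] (hh : IsHyp h d e) {w : α → ℝ}
    (hw : w ∈ closureCone h e) {l : ℝ}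
    (hline : ∀ s : ℝ, MvPolynomial.eval (e + s • w) h = MvPolynomial.eval e h * (1 + s * l)) :
    dirDeriv w (dirDeriv w h) = 0 := by
  have hnear : ∀ x ∈ openCone h e, (2 : ℝ) • e - x ∈ openCone h e →
      MvPolynomial.eval x (dirDeriv w (dirDeriv w h)) = 0 := by
    intro x hx hx'
    have hbound : ∀ s : ℝ, 0 ≤ s → |(linePoly h x w).eval s| ≤
        2 ^ d * MvPolynomial.eval e h + 2 ^ d * MvPolynomial.eval e h * (l / 2) * s := by
      intro s hs
      have hxs : x + s • w ∈ openCone h e := hh.add_closure_mem hx (hh.smul_mem_closure hw hs)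
      rw [eval_linePoly_real, abs_of_pos (eval_pos_of_mem_openCone hxs)]
      have := hh.eval_add_smul_mono hxs hx' le_rfl zero_le_one
      rw [zero_smul, add_zero, one_smul] at this
      refine this.trans (le_of_eq ?_)
      have heq : x + s • w + ((2 : ℝ) • e - x) = (2 : ℝ) • (e + (s / 2) • w) := by
        rw [smul_add, smul_smul, mul_div_cancel₀ _ two_ne_zero]
        abel
      rw [heq, eval_smul_of_isHomogeneous hh.homogeneous, hline]
      ring
    have hdeg := natDegree_le_one_of_abs_le hbound
    have h2 : Polynomial.derivative (Polynomial.derivative (linePoly h x w)) = 0 := by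
      have h1 : (Polynomial.derivative (linePoly h x w)).natDegree = 0 := by
        have := Polynomial.natDegree_derivative_le (linePoly h x w)
        omega
      rw [Polynomial.eq_C_of_natDegree_eq_zero h1, Polynomial.derivative_C]
    have hd1 := fun g : MvPolynomial α ℝ => derivative_linePoly (K := ℝ) g x w
    simp only [Algebra.algebraMap_self, RingHom.id_apply] at hd1
    change Polynomial.derivative (Polynomial.derivative (linePoly h x fun i => w i)) = 0 at h2
    rw [hd1, hd1] at h2
    have := congrArg (Polynomial.eval 0) h2
    rw [eval_linePoly_real] at this
    simpa using this
  refine MvPolynomial.funext fun y => ?_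
  rw [map_zero]
  obtain ⟨η₀, hη₀, hmem⟩ := hh.exists_add_smul_mem y
  set R := dirDeriv w (dirDeriv w h)
  have hR : R.IsHomogeneous (d - 1 - 1) :=
    isHomogeneous_dirDeriv _ (isHomogeneous_dirDeriv _ hh.homogeneous)
  have hzero : linePoly R e y = 0 := by
    refine Polynomial.eq_zero_of_infinite_isRoot _ ((Ioo_infinite hη₀).mono fun η hη => ?_)
    have hη' : |η| < η₀ := by rw [abs_of_pos hη.1]; exact hη.2
    change (linePoly R e y).eval η = 0
    rw [eval_linePoly_real]
    refine hnear _ (hmem η hη') ?_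
    have := hmem (-η) (by rwa [abs_neg])
    rwa [show (2 : ℝ) • e - (e + η • y) = e + (-η) • y by rw [two_smul, neg_smul]; abel]
  have := (natDegree_linePoly_le_and_coeff hR e y).2
  rw [hzero] at this
  simpa [MvPolynomial.coe_aeval_eq_eval] using this.symm

variable {ι : Type*} [Fintype ι] {u : ι → α → ℝ}

theorem mixEval_add_smul_of_dirDeriv_dirDeriv (x v : α → ℝ) (τ : ι → ℝ)
    (hv : dirDeriv v (dirDeriv v h) = 0) (t : ℝ) :
    mixEval u h (x + t • v) τ = mixEval u h x τ + t * mixEval u (dirDeriv v h) x τ := by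
  have hconst : ∀ t : ℝ, mixEval u (dirDeriv v h) (x + t • v) τ =
      mixEval u (dirDeriv v h) x τ := by
    intro t
    have hd : ∀ t, HasDerivAt (fun t : ℝ => mixEval u (dirDeriv v h) (x + t • v) τ) 0 t :=
      fun t => by
        have := hasDerivAt_mixEval u (dirDeriv v h) x v τ t
        rwa [hv, mixEval, mixPoly_zero, map_zero] at this
    have := is_const_of_deriv_eq_zero (fun t => (hd t).differentiableAt) (fun t => (hd t).deriv) t 0
    simpa using this
  set c := mixEval u (dirDeriv v h) x τ
  have hd : ∀ t, HasDerivAt (fun t : ℝ => mixEval u h (x + t • v) τ - t * c) 0 t := fun t => by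
    have h1 := (hasDerivAt_mixEval u h x v τ t).sub ((hasDerivAt_id t).mul_const c)
    rw [hconst, one_mul, sub_self] at h1
    exact h1
  have := is_const_of_deriv_eq_zero (fun t => (hd t).differentiableAt) (fun t => (hd t).deriv) t 0
  simp only [zero_smul, add_zero, zero_mul, sub_zero] at this
  linarith

/-- For vectors of rank one, applying `∏ (1 - D_{u_j})` amounts to subtracting the vectors. -/
theorem mixEval_sum_single [DecidableEq ι] (B : Finset ι)
    (hB : ∀ b ∈ B, dirDeriv (u b) (dirDeriv (u b) h) = 0) (x : α → ℝ) :
    mixEval u h x (∑ b ∈ B, Pi.single b 1) = MvPolynomial.eval (x - ∑ b ∈ B, u b) h := by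
  induction B using Finset.induction_on generalizing x with
  | empty => simp [mixEval_zero]
  | insert b B hb ih =>
    rw [Finset.sum_insert hb, Finset.sum_insert hb, add_comm,
      ← one_smul ℝ (Pi.single b 1 : ι → ℝ), mixEval_add_single _ _ _ (sum_single_apply_of_notMem hb)]
    have h1 := mixEval_add_smul_of_dirDeriv_dirDeriv (u := u) x (u b) (∑ j ∈ B, Pi.single j 1)
      (hB b (Finset.mem_insert_self b B)) (-1)
    have h2 := ih (fun c hc => hB c (Finset.mem_insert_of_mem hc)) (x + (-1 : ℝ) • u b)
    rw [show x - (u b + ∑ j ∈ B, u j) = x + (-1 : ℝ) • u b - ∑ j ∈ B, u j by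
      rw [neg_smul, one_smul]; abel, ← h2, h1]
    ring

end RankOne

/-! ### Eigenvalues -/

section Eigenvalues

open Set Topology

variable {n : ℕ} {h : MvPolynomial (Fin n) ℝ} {e : Fin n → ℝ} {d : ℕ}

theorem pencil_eq_linePoly (h : MvPolynomial (Fin n) ℝ) (e x : Fin n → ℝ) :
    pencil h e x = linePoly h (-x) e := by
  rw [pencil, linePoly]
  congr 2
  ext1 i
  simp [sub_eq_neg_add]

theorem pencil_C_mul (a : ℝ) (h : MvPolynomial (Fin n) ℝ) (e x : Fin n → ℝ) :
    pencil (MvPolynomial.C a * h) e x = Polynomial.C a * pencil h e x := by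
  simp [pencil]

theorem eigenvalues_C_mul {a : ℝ} (ha : a ≠ 0) (h : MvPolynomial (Fin n) ℝ) (e x : Fin n → ℝ) :
    eigenvalues (MvPolynomial.C a * h) e x = eigenvalues h e x := by
  rw [eigenvalues, pencil_C_mul, Polynomial.roots_C_mul _ ha, eigenvalues]

theorem IsHyperbolic.C_mul (hh : IsHyperbolic h e) {a : ℝ} (ha : a ≠ 0) :
    IsHyperbolic (MvPolynomial.C a * h) e where
  homogeneous := hh.homogeneous.imp fun _ hd => hd.C_mul a
  eval_ne_zero := by simpa using ⟨ha, hh.eval_ne_zero⟩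
  realRooted x := by
    rw [pencil_C_mul]
    exact (Polynomial.Splits.C a).mul (hh.realRooted x)

theorem aeval_ne_zero_of_eval_ne_zero (hh : IsHyperbolic h e) :
    MvPolynomial.aeval e h ≠ 0 := by
  simpa [MvPolynomial.coe_aeval_eq_eval] using hh.eval_ne_zero

theorem map_linePoly (h : MvPolynomial (Fin n) ℝ) (a b : Fin n → ℝ) :
    (linePoly h a b).map (algebraMap ℝ ℂ) = linePoly h (rvec a) (rvec b) := by
  have key : (Polynomial.mapAlgHom (Algebra.ofId ℝ ℂ)).comp
      (MvPolynomial.aeval (fun i => Polynomial.C (a i) + Polynomial.X * Polynomial.C (b i))) =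
      MvPolynomial.aeval (R := ℝ)
        (fun i => Polynomial.C (rvec a i) + Polynomial.X * Polynomial.C (rvec b i)) := by
    apply MvPolynomial.algHom_ext
    intro i
    simp [rvec]
  exact congrArg (fun φ => φ h) key

theorem IsHyperbolic.isHyp (hh : IsHyperbolic h e) (hd : h.IsHomogeneous d)
    (h1 : MvPolynomial.eval e h = 1) : IsHyp h d e where
  homogeneous := hd
  pos := by rw [h1]; exact one_pos
  ne_zero x := by
    have hs := hh.realRooted (-x)
    rw [pencil_eq_linePoly, neg_neg] at hs
    have heq : cvec x e = rvec x + Complex.I • rvec e := by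
      ext i; simp [cvec, rvec, mul_comm]
    rw [heq, ← eval_linePoly, ← map_linePoly, Polynomial.eval_map_algebraMap,
      hs.eq_prod_roots, leadingCoeff_linePoly hd x (aeval_ne_zero_of_eval_ne_zero hh)]
    simp only [map_mul, Polynomial.aeval_C, map_multiset_prod, Multiset.map_map]
    refine mul_ne_zero ?_ ?_
    · have := aeval_ne_zero_of_eval_ne_zero hh
      simpa using this
    · refine Multiset.prod_ne_zero fun h0 => ?_
      obtain ⟨r, _, hr⟩ := Multiset.mem_map.1 h0
      have := congrArg Complex.im hr
      simp at this

theorem card_eigenvalues (hh : IsHyperbolic h e) (hd : h.IsHomogeneous d) (x : Fin n → ℝ) :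
    (eigenvalues h e x).card = d := by
  rw [eigenvalues, ← (hh.realRooted x).natDegree_eq_card_roots, pencil_eq_linePoly,
    natDegree_linePoly hd _ (aeval_ne_zero_of_eval_ne_zero hh)]

theorem eval_add_smul_eq_prod (hh : IsHyperbolic h e) (hd : h.IsHomogeneous d)
    (h1 : MvPolynomial.eval e h = 1) (x : Fin n → ℝ) (t : ℝ) :
    MvPolynomial.eval (x + t • e) h = ((eigenvalues h e x).map fun l => l + t).prod := by
  have hp := (hh.realRooted x).eval_eq_prod_roots (-t)
  have hl : (pencil h e x).leadingCoeff = 1 := by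
    rw [pencil_eq_linePoly, leadingCoeff_linePoly hd _ (aeval_ne_zero_of_eval_ne_zero hh)]
    simpa [MvPolynomial.coe_aeval_eq_eval] using h1
  rw [eval_pencil, hl, one_mul] at hp
  have hneg : x + t • e = (-1 : ℝ) • ((-t) • e - x) := by
    rw [smul_sub, smul_smul, neg_smul, one_smul]
    simp [add_comm]
  rw [hneg, eval_smul_of_isHomogeneous hd, hp, ← card_eigenvalues hh hd x, eigenvalues]
  generalize (pencil h e x).roots = R
  induction R using Multiset.induction_on with
  | empty => simp
  | cons l R ih =>
    simp only [Multiset.map_cons, Multiset.prod_cons, Multiset.card_cons, ← ih]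
    ring

theorem eval_self_add_smul_eq_prod (hh : IsHyperbolic h e) (hd : h.IsHomogeneous d)
    (h1 : MvPolynomial.eval e h = 1) (x : Fin n → ℝ) (s : ℝ) :
    MvPolynomial.eval (e + s • x) h = ((eigenvalues h e x).map fun l => 1 + s * l).prod := by
  rcases eq_or_ne s 0 with rfl | hs
  · simp [h1]
  · have heq : e + s • x = s • (x + s⁻¹ • e) := by
      rw [smul_add, smul_inv_smul₀ hs, add_comm]
    rw [heq, eval_smul_of_isHomogeneous hd, eval_add_smul_eq_prod hh hd h1,
      ← card_eigenvalues hh hd x]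
    generalize eigenvalues h e x = R
    induction R using Multiset.induction_on with
    | empty => simp
    | cons l R ih =>
      simp only [Multiset.map_cons, Multiset.prod_cons, Multiset.card_cons, ← ih]
      field_simp
      ring

theorem mem_closureCone_of_mem_closedCone (hh : IsHyperbolic h e) (hd : h.IsHomogeneous d)
    (h1 : MvPolynomial.eval e h = 1) {x : Fin n → ℝ} (hx : x ∈ closedCone h e) :
    x ∈ closureCone h e := by
  rw [mem_closureCone_iff]
  intro t ht
  rw [eval_add_smul_eq_prod hh hd h1]
  have hx : 0 ≤ lambdaMin h e x := hx
  have hnonneg : ∀ l ∈ eigenvalues h e x, 0 ≤ l := by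
    intro l hl
    refine hx.trans (csInf_le ?_ hl)
    exact ((eigenvalues h e x).toFinset.finite_toSet.subset fun l hl => by
      simpa using hl).bddBelow
  refine Multiset.prod_pos fun r hr => ?_
  obtain ⟨l, hl, rfl⟩ := Multiset.mem_map.1 hr
  have := hnonneg l hl
  positivity

theorem eval_dirDeriv_eq_trace (hh : IsHyperbolic h e) (hd : h.IsHomogeneous d)
    (h1 : MvPolynomial.eval e h = 1) (x : Fin n → ℝ) :
    MvPolynomial.eval e (dirDeriv x h) = trace h e x := by
  have hder := hasDerivAt_eval_line h e x 0
  rw [zero_smul, add_zero] at hder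
  simp only [eval_self_add_smul_eq_prod hh hd h1] at hder
  refine hder.unique ?_
  rw [trace]
  generalize eigenvalues h e x = R
  induction R using Multiset.induction_on with
  | empty => simpa using hasDerivAt_const (0 : ℝ) (1 : ℝ)
  | cons l R ih =>
    simp only [Multiset.map_cons, Multiset.prod_cons, Multiset.sum_cons]
    have h2 : HasDerivAt (fun s : ℝ => 1 + s * l) l 0 := by
      simpa using ((hasDerivAt_id (0 : ℝ)).mul_const l).const_add 1
    have h3 := h2.mul ih
    simp only [zero_mul, add_zero, one_mul, Multiset.map_const', Multiset.prod_replicate,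
      one_pow, mul_one] at h3
    exact h3

theorem dirDeriv_dirDeriv_eq_zero_of_rank_le_one (hh : IsHyperbolic h e)
    (hd : h.IsHomogeneous d) (h1 : MvPolynomial.eval e h = 1) {w : Fin n → ℝ}
    (hw : w ∈ closedCone h e) (hr : rank h e w ≤ 1) : dirDeriv w (dirDeriv w h) = 0 := by
  have hfilter : ∀ s : ℝ, MvPolynomial.eval (e + s • w) h =
      (((eigenvalues h e w).filter (fun t => t ≠ 0)).map fun l => 1 + s * l).prod := by
    intro s
    rw [eval_self_add_smul_eq_prod hh hd h1]
    generalize eigenvalues h e w = R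
    induction R using Multiset.induction_on with
    | empty => simp
    | cons l R ih =>
      by_cases hl : l = 0
      · rw [Multiset.filter_cons_of_neg _ (by simpa using hl), Multiset.map_cons,
          Multiset.prod_cons, ih, hl]
        simp
      · rw [Multiset.filter_cons_of_pos _ (by simpa using hl), Multiset.map_cons,
          Multiset.prod_cons, ih, Multiset.map_cons, Multiset.prod_cons]
  have hex : ∃ l : ℝ, ∀ s : ℝ,
      (((eigenvalues h e w).filter (fun t => t ≠ 0)).map fun l => 1 + s * l).prod = 1 + s * l := by
    rw [rank] at hr
    rcases Nat.le_one_iff_eq_zero_or_eq_one.1 hr with h0 | h0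
    · rw [Multiset.card_eq_zero.1 h0]
      exact ⟨0, fun s => by simp⟩
    · obtain ⟨l, hl⟩ := Multiset.card_eq_one.1 h0
      rw [hl]
      exact ⟨l, fun s => by simp⟩
  obtain ⟨l, hl⟩ := hex
  refine (hh.isHyp hd h1).dirDeriv_dirDeriv_eq_zero
    (mem_closureCone_of_mem_closedCone hh hd h1 hw) (l := l) fun s => ?_
  rw [hfilter, hl, h1, one_mul]

theorem lambdaMax_le_of_forall_pos {x : Fin n → ℝ} {c : ℝ} (hc : 0 ≤ c)
    (hpos : ∀ t : ℝ, 0 ≤ t → 0 < MvPolynomial.eval ((c + t) • e - x) h) :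
    lambdaMax h e x ≤ c := by
  refine Real.sSup_le (fun l hl => ?_) hc
  by_contra hlt
  have hroot : (pencil h e x).eval l = 0 := Polynomial.isRoot_of_mem_roots hl
  rw [eval_pencil] at hroot
  have := hpos (l - c) (by linarith)
  rw [add_sub_cancel, hroot] at this
  exact lt_irrefl _ this

theorem eval_dirDeriv_self (hd : h.IsHomogeneous d) (h1 : MvPolynomial.eval e h = 1) :
    MvPolynomial.eval e (dirDeriv e h) = d := by
  have hder := hasDerivAt_eval_line h e e 0
  rw [zero_smul, add_zero] at hder
  have heq : ∀ t : ℝ, MvPolynomial.eval (e + t • e) h = (1 + t) ^ d := by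
    intro t
    rw [show e + t • e = (1 + t) • e by rw [add_smul, one_smul],
      eval_smul_of_isHomogeneous hd, h1, mul_one]
  simp only [heq] at hder
  refine hder.unique ?_
  have h2 := ((hasDerivAt_id (0 : ℝ)).const_add 1).fun_pow d
  simpa using h2

end Eigenvalues

/-! ### Existence of a good choice of values -/

section Choice

open Set Topology

variable {α : Type*} [Fintype α] {h : MvPolynomial α ℝ} {d : ℕ} {e : α → ℝ}

/-- The deterministic core: random vectors with finitely many values of rank one in the cone, given
by their weights `p i`, take with positive probability values whose sum is smaller than `r² e` in
the order of the hyperbolicity cone. -/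
theorem exists_choice_forall_pos (hh : IsHyp h d e) (hd : 0 < d) {m : ℕ} (hm : 0 < m)
    (S : Finset (α → ℝ)) (hcone : ∀ w ∈ S, w ∈ closureCone h e)
    (hrank : ∀ w ∈ S, dirDeriv w (dirDeriv w h) = 0) (p : Fin m → (α → ℝ) → ℝ)
    (hp : ∀ i, ∀ w ∈ S, 0 ≤ p i w) (hp1 : ∀ i, ∑ w ∈ S, p i w = 1)
    (hsum : ∑ i, ∑ w ∈ S, p i w • w = e) {ε r : ℝ}
    (htr : ∀ i, MvPolynomial.eval e (dirDeriv (∑ w ∈ S, p i w • w) h) ≤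
      ε * MvPolynomial.eval e h)
    (hr : 1 < r) (hε : ε < r ^ 2 / m + (1 - 1 / m) * (r - 1) ^ 2) :
    ∃ c : Fin m → α → ℝ, (∀ i, c i ∈ S ∧ 0 < p i (c i)) ∧
      ∀ t : ℝ, 0 ≤ t → 0 < MvPolynomial.eval ((r ^ 2 + t) • e - ∑ i, c i) h := by
  classical
  -- the index `(i, none)` carries the mean of the `i`-th vector, `(i, some w)` the value `w`
  set u : Fin m × Option S → α → ℝ := fun k =>
    k.2.elim (∑ w ∈ S, p k.1 w • w) fun w => (w : α → ℝ) with hudef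
  have hu : ∀ k, u k ∈ closureCone h e := by
    rintro ⟨i, _ | w⟩
    · exact hh.sum_mem_closure S fun w hw => hh.smul_mem_closure (hcone w hw) (hp i w hw)
    · exact hcone _ w.2
  have hstart : MixAbove u h e (r ^ 2 • e) (∑ i : Fin m, Pi.single (i, none) 1) := by
    set A : Finset (Fin m × Option S) :=
      Finset.univ.map ⟨fun i => (i, none), fun i j h => (Prod.ext_iff.1 h).1⟩ with hA
    have hcard : A.card = m := by simp [hA]
    have := mixAbove_sq_smul hh hd hu (A := A) (ε := ε) (r := r)
      (by rw [← Finset.card_pos, hcard]; exact hm) (by rw [hA, Finset.sum_map]; exact hsum)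
      (by simp only [hA, Finset.mem_map]; rintro _ ⟨i, _, rfl⟩; exact htr i) hr
      (by rw [hcard]; exact hε)
    rw [hA, Finset.sum_map] at this
    exact this
  have hstep : ∀ J : Finset (Fin m), ∃ c : Fin m → Option S,
      (∀ i ∈ J, ∃ w : S, c i = some w ∧ 0 < p i w) ∧ (∀ i, i ∉ J → c i = none) ∧
      MixAbove u h e (r ^ 2 • e) (∑ i, Pi.single (i, c i) 1) := by
    intro J
    induction J using Finset.induction_on with
    | empty => exact ⟨fun _ => none, by simp, by simp, hstart⟩
    | insert j J hj ih =>
      obtain ⟨c, hc, hc', habove⟩ := ih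
      rw [← Finset.sum_erase_add _ _ (Finset.mem_univ j), hc' j hj] at habove
      have hzero : ∀ o : Option S,
          (∑ i ∈ Finset.univ.erase j, Pi.single (i, c i) 1 : Fin m × Option S → ℝ) (j, o) = 0 := by
        intro o
        rw [Finset.sum_apply]
        refine Finset.sum_eq_zero fun i hi => Pi.single_eq_of_ne ?_ _
        intro heq
        exact Finset.ne_of_mem_erase hi (Prod.ext_iff.1 heq).1.symm
      set B : Finset (Fin m × Option S) :=
        Finset.univ.map ⟨fun w : S => (j, some w), fun w w' h => by simpa using h⟩ with hB
      obtain ⟨b, hb, hpb, hnew⟩ := habove.exists_replace hh hu (hzero none) (B := B)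
        (p := fun k => k.2.elim 0 fun w => p k.1 w)
        (by simp only [hB, Finset.mem_map]; rintro _ ⟨w, _, rfl⟩; exact hzero _)
        (by simp only [hB, Finset.mem_map]; rintro _ ⟨w, _, rfl⟩; exact hp _ _ w.2)
        (by
          rw [hB, Finset.sum_map, ← hp1 j, ← Finset.sum_coe_sort S]
          rfl)
        (by
          rw [hB, Finset.sum_map]
          change ∑ w ∈ S, p j w • w = _
          rw [← Finset.sum_coe_sort S]
          rfl)
      simp only [hB, Finset.mem_map] at hb
      obtain ⟨w, _, rfl⟩ := hb
      refine ⟨Function.update c j (some w), ?_, ?_, ?_⟩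
      · intro i hi
        rcases eq_or_ne i j with rfl | hij
        · exact ⟨w, by simp, hpb⟩
        · rw [Function.update_of_ne hij]
          exact hc i (Finset.mem_of_mem_insert_of_ne hi hij)
      · intro i hi
        rw [Finset.mem_insert, not_or] at hi
        rw [Function.update_of_ne hi.1]
        exact hc' i hi.2
      · rw [← Finset.sum_erase_add _ _ (Finset.mem_univ j), Function.update_self]
        convert! hnew using 2
        refine Finset.sum_congr rfl fun i hi => ?_
        rw [Function.update_of_ne (Finset.ne_of_mem_erase hi)]
  obtain ⟨c, hc, -, habove⟩ := hstep Finset.univ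
  choose w hw hpw using fun i => hc i (Finset.mem_univ i)
  refine ⟨fun i => w i, fun i => ⟨(w i).2, hpw i⟩, fun t ht => ?_⟩
  have hpos := mixAbove_iff.1 habove t ht
  have hfin := mixEval_sum_single (u := u) (h := h)
    (Finset.univ.map ⟨fun i : Fin m => (i, some (w i)), fun i j h => (Prod.ext_iff.1 h).1⟩)
    (by
      simp only [Finset.mem_map]
      rintro _ ⟨i, _, rfl⟩
      exact hrank _ (w i).2) (r ^ 2 • e + t • e)
  rw [Finset.sum_map, Finset.sum_map] at hfin
  simp only [hw] at hpos
  rw [add_smul]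
  exact lt_of_lt_of_eq hpos hfin

end Choice

/-! ### Passing to random vectors -/

section Probability

open Set Topology

/-- A random vector with values in a finite set has mean and total mass given by the weights of its
atoms. -/
theorem integral_eq_sum_of_ae_mem {n : ℕ} {Ω : Type*} [MeasurableSpace Ω] {μ : Measure Ω}
    [IsProbabilityMeasure μ] {X : Ω → Fin n → ℝ} (hX : Measurable X) (T : Finset (Fin n → ℝ))
    (hT : ∀ᵐ ω ∂μ, X ω ∈ T) :
    ∫ ω, X ω ∂μ = ∑ w ∈ T, μ.real (X ⁻¹' {w}) • w ∧ ∑ w ∈ T, μ.real (X ⁻¹' {w}) = 1 ∧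
      Integrable X μ := by
  classical
  have hms : ∀ w, MeasurableSet (X ⁻¹' {w}) := fun w => hX (measurableSet_singleton w)
  have hgen : ∀ {E : Type} [NormedAddCommGroup E] [NormedSpace ℝ E] [CompleteSpace E]
      (f : (Fin n → ℝ) → E),
      ∫ ω, f (X ω) ∂μ = ∑ w ∈ T, μ.real (X ⁻¹' {w}) • f w ∧ Integrable (fun ω => f (X ω)) μ := by
    intro E _ _ _ f
    have hae : (fun ω => f (X ω)) =ᵐ[μ]
        fun ω => ∑ w ∈ T, (X ⁻¹' {w}).indicator (fun _ => f w) ω := by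
      filter_upwards [hT] with ω hω
      rw [Finset.sum_eq_single_of_mem _ hω]
      · rw [indicator_of_mem (by simp)]
      · intro w _ hw
        exact indicator_of_notMem (by simpa using hw.symm) _
    have hint : ∀ w ∈ T, Integrable ((X ⁻¹' {w}).indicator (fun _ => f w)) μ := fun w _ =>
      (integrable_const (f w)).indicator (hms w)
    refine ⟨?_, (integrable_finsetSum T hint).congr hae.symm⟩
    rw [integral_congr_ae hae, integral_finsetSum T hint]
    exact Finset.sum_congr rfl fun w _ => integral_indicator_const _ (hms w)
  refine ⟨(hgen fun w => w).1, ?_, (hgen fun w => w).2⟩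
  have := (hgen fun _ => (1 : ℝ)).1
  simpa using this.symm

/-- The theorem under the normalization `h e = 1`. -/
theorem measure_lambdaMax_sum_le_delta_pos_of_eval_eq_one {n m : ℕ} (h : MvPolynomial (Fin n) ℝ) (e : Fin n → ℝ)
    (hh : IsHyperbolic h e) (h1 : MvPolynomial.eval e h = 1)
    {Ω : Type*} [MeasurableSpace Ω] (μ : Measure Ω) [IsProbabilityMeasure μ]
    (X : Fin m → Ω → (Fin n → ℝ))
    (hmeas : ∀ i, Measurable (X i))
    (hindep : iIndepFun X μ)
    (hfin : ∀ i, ∃ S : Set (Fin n → ℝ), S.Finite ∧ ∀ᵐ ω ∂μ, X i ω ∈ S)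
    (hcone : ∀ i, ∀ᵐ ω ∂μ, X i ω ∈ closedCone h e)
    (hrank : ∀ i, ∀ᵐ ω ∂μ, rank h e (X i ω) ≤ 1)
    (hsum : ∫ ω, ∑ i, X i ω ∂μ = e)
    (ε : ℝ)
    (htrace : ∀ i, trace h e (∫ ω, X i ω ∂μ) ≤ ε) :
    0 < μ {ω | lambdaMax h e (∑ i, X i ω) ≤ delta ε m} := by
  classical
  obtain ⟨d, hd⟩ := hh.homogeneous
  rcases Nat.eq_zero_or_pos d with rfl | hdpos
  · -- a constant polynomial has no eigenvalues
    have hempty : ∀ x, lambdaMax h e x = 0 := by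
      intro x
      rw [lambdaMax, Multiset.card_eq_zero.1 (card_eigenvalues hh hd x)]
      simp
    have : {ω | lambdaMax h e (∑ i, X i ω) ≤ delta ε m} = univ :=
      eq_univ_of_forall fun ω => by
        change lambdaMax h e _ ≤ _
        rw [hempty]
        exact sq_nonneg _
    rw [this]
    simp
  have hhyp := hh.isHyp hd h1
  choose S₀ hS₀ hS₀X using hfin
  set T : Finset (Fin n → ℝ) := Finset.univ.biUnion fun i => (hS₀ i).toFinset with hT
  have hTX : ∀ i, ∀ᵐ ω ∂μ, X i ω ∈ T := by
    intro i
    filter_upwards [hS₀X i] with ω hω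
    exact Finset.mem_biUnion.2 ⟨i, Finset.mem_univ i, (hS₀ i).mem_toFinset.2 hω⟩
  set p : Fin m → (Fin n → ℝ) → ℝ := fun i w => μ.real (X i ⁻¹' {w}) with hp
  have hp0 : ∀ i w, 0 ≤ p i w := fun i w => measureReal_nonneg
  set S : Finset (Fin n → ℝ) := T.filter fun w => ∃ i, p i w ≠ 0 with hS
  have hgood : ∀ w ∈ S, w ∈ closedCone h e ∧ rank h e w ≤ 1 := by
    intro w hw
    obtain ⟨i, hi⟩ := (Finset.mem_filter.1 hw).2
    have hne : μ (X i ⁻¹' {w}) ≠ 0 := fun h0 => hi (by simp [hp, Measure.real, h0])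
    have hfreq : ∃ᵐ ω ∂μ, ω ∈ X i ⁻¹' {w} := frequently_ae_mem_iff.2 hne
    obtain ⟨ω, hω, hc, hr⟩ := (hfreq.and_eventually ((hcone i).and (hrank i))).exists
    rw [← show X i ω = w from hω]
    exact ⟨hc, hr⟩
  have hdata := fun i => integral_eq_sum_of_ae_mem (hmeas i) T (hTX i)
  have hmean : ∀ i, ∫ ω, X i ω ∂μ = ∑ w ∈ S, p i w • w := by
    intro i
    rw [(hdata i).1, hS]
    refine (Finset.sum_filter_of_ne fun w _ hw => ⟨i, fun h0 => hw ?_⟩).symm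
    change p i w • w = 0
    rw [h0, zero_smul]
  have hmass : ∀ i, ∑ w ∈ S, p i w = 1 := by
    intro i
    rw [← (hdata i).2.1, hS]
    exact Finset.sum_filter_of_ne fun w _ hw => ⟨i, hw⟩
  have hsum' : ∑ i, ∑ w ∈ S, p i w • w = e := by
    rw [← hsum, integral_finsetSum _ fun i _ => (hdata i).2.2]
    exact Finset.sum_congr rfl fun i _ => (hmean i).symm
  have htr : ∀ i, MvPolynomial.eval e (dirDeriv (∑ w ∈ S, p i w • w) h) ≤ ε := by
    intro i
    rw [eval_dirDeriv_eq_trace hh hd h1, ← hmean i]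
    exact htrace i
  have hdm : (d : ℝ) ≤ m * ε := by
    have hD : dirDeriv e h = ∑ i, dirDeriv (∑ w ∈ S, p i w • w) h := by
      rw [← dirDeriv_sum, hsum']
    rw [← eval_dirDeriv_self hd h1, hD, map_sum]
    refine (Finset.sum_le_sum fun i _ => htr i).trans (le_of_eq ?_)
    simp
  have hd1 : (1 : ℝ) ≤ d := by exact_mod_cast hdpos
  have hm : 0 < m := by
    rcases Nat.eq_zero_or_pos m with rfl | hm
    · simp at hdm; linarith
    · exact hm
  have hm1 : (1 : ℝ) ≤ m := by exact_mod_cast hm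
  set c : ℝ := 1 - 1 / (m : ℝ) with hc
  have hmc : 1 / (m : ℝ) = 1 - c := by rw [hc]; ring
  have hc0 : 0 ≤ c := by
    rw [hc, sub_nonneg, div_le_one (by linarith)]; exact hm1
  have hεm : 1 - c ≤ ε := by
    rw [← hmc, div_le_iff₀ (by linarith)]; linarith
  set r₀ : ℝ := c + √(ε - 1 / (m : ℝ) * c) with hr₀
  have hdelta : delta ε m = r₀ ^ 2 := rfl
  have hsq : (1 - c) ^ 2 ≤ ε - 1 / (m : ℝ) * c := by rw [hmc]; nlinarith
  have hc1 : 0 ≤ 1 - c := by rw [← hmc]; positivity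
  have hr₀1 : 1 ≤ r₀ := by
    have := Real.le_sqrt_of_sq_le hsq
    linarith
  -- the threshold `r₀` is the larger root of `r² / m + (1 - 1 / m) (r - 1)² = ε`
  have hquad : ∀ r, r₀ < r → ε < r ^ 2 / m + (1 - 1 / m) * (r - 1) ^ 2 := by
    intro r hr
    have h2 : √(ε - 1 / (m : ℝ) * c) ^ 2 = ε - 1 / (m : ℝ) * c :=
      Real.sq_sqrt ((sq_nonneg _).trans hsq)
    have h3 : √(ε - 1 / (m : ℝ) * c) < r - c := by linarith
    have h4 := pow_lt_pow_left₀ h3 (Real.sqrt_nonneg _) two_ne_zero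
    rw [h2, hmc] at h4
    rw [← hc, div_eq_mul_one_div, hmc]
    nlinarith
  -- the choices of values of positive probability form a finite set
  set G : Finset (Fin m → Fin n → ℝ) :=
    (Fintype.piFinset fun _ => S).filter fun c => ∀ i, 0 < p i (c i) with hG
  have hex : ∀ r, r₀ < r → ∃ c ∈ G, lambdaMax h e (∑ i, c i) ≤ r ^ 2 := by
    intro r hr
    obtain ⟨c, hcS, hpos⟩ := exists_choice_forall_pos hhyp hdpos hm S
      (fun w hw => mem_closureCone_of_mem_closedCone hh hd h1 (hgood w hw).1)
      (fun w hw => dirDeriv_dirDeriv_eq_zero_of_rank_le_one hh hd h1 (hgood w hw).1 (hgood w hw).2)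
      p (fun i w _ => hp0 i w) hmass hsum' (ε := ε) (r := r)
      (fun i => by rw [h1, mul_one]; exact htr i) (by linarith) (hquad r hr)
    refine ⟨c, ?_, lambdaMax_le_of_forall_pos (sq_nonneg r) hpos⟩
    rw [hG, Finset.mem_filter, Fintype.mem_piFinset]
    exact ⟨fun i => (hcS i).1, fun i => (hcS i).2⟩
  have hGne : G.Nonempty := by
    obtain ⟨c, hc, -⟩ := hex (r₀ + 1) (by linarith)
    exact ⟨c, hc⟩
  obtain ⟨v, hvG, hvmin⟩ := G.exists_min_image (fun c => lambdaMax h e (∑ i, c i)) hGne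
  have hv : lambdaMax h e (∑ i, v i) ≤ delta ε m := by
    have hlim : Filter.Tendsto (fun r : ℝ => r ^ 2) (𝓝[>] r₀) (𝓝 (r₀ ^ 2)) :=
      ((continuous_pow 2).tendsto r₀).mono_left nhdsWithin_le_nhds
    rw [hdelta]
    refine ge_of_tendsto hlim ?_
    filter_upwards [self_mem_nhdsWithin] with r hr
    obtain ⟨c, hc, hle⟩ := hex r hr
    exact (hvmin c hc).trans hle
  have hprob : μ (⋂ i ∈ (Finset.univ : Finset (Fin m)), X i ⁻¹' {v i}) =
      ∏ i ∈ (Finset.univ : Finset (Fin m)), μ (X i ⁻¹' {v i}) :=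
    hindep.measure_inter_preimage_eq_mul Finset.univ
      fun i _ => measurableSet_singleton (v i)
  refine lt_of_lt_of_le ?_ (measure_mono (μ := μ)
    (s := ⋂ i ∈ (Finset.univ : Finset (Fin m)), X i ⁻¹' {v i}) fun ω hω => ?_)
  · rw [hprob]
    refine pos_iff_ne_zero.2 (Finset.prod_ne_zero_iff.2 fun i _ h0 => ?_)
    have := (Finset.mem_filter.1 hvG).2 i
    simp [hp, Measure.real, h0] at this
  · simp only [Finset.mem_univ, iInter_true, mem_iInter, mem_preimage, mem_singleton_iff] at hω
    change lambdaMax h e (∑ i, X i ω) ≤ delta ε m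
    simp only [hω]
    exact hv

end Probability
end HypPoly
end

theorem theorem5p1 {n m : ℕ} (h : MvPolynomial (Fin n) ℝ) (e : Fin n → ℝ)
    (hh : HypPoly.IsHyperbolic h e)
    {Ω : Type*} [MeasurableSpace Ω] (μ : Measure Ω) [IsProbabilityMeasure μ]
    (X : Fin m → Ω → (Fin n → ℝ))
    (hmeas : ∀ i, Measurable (X i))
    (hindep : iIndepFun X μ)
    (hfin : ∀ i, ∃ S : Set (Fin n → ℝ), S.Finite ∧ ∀ᵐ ω ∂μ, X i ω ∈ S)
    (hcone : ∀ i, ∀ᵐ ω ∂μ, X i ω ∈ HypPoly.closedCone h e)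
    (hrank : ∀ i, ∀ᵐ ω ∂μ, HypPoly.rank h e (X i ω) ≤ 1)
    (hsum : ∫ ω, ∑ i, X i ω ∂μ = e)
    (ε : ℝ)
    (htrace : ∀ i, HypPoly.trace h e (∫ ω, X i ω ∂μ) ≤ ε) :
    0 < μ {ω | HypPoly.lambdaMax h e (∑ i, X i ω) ≤ HypPoly.delta ε m} := by
  have ha : (MvPolynomial.eval e h)⁻¹ ≠ 0 := inv_ne_zero hh.eval_ne_zero
  have hev := HypPoly.eigenvalues_C_mul ha h e
  have h1 : MvPolynomial.eval e (MvPolynomial.C (MvPolynomial.eval e h)⁻¹ * h) = 1 := by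
    rw [map_mul, MvPolynomial.eval_C, inv_mul_cancel₀ hh.eval_ne_zero]
  have := HypPoly.measure_lambdaMax_sum_le_delta_pos_of_eval_eq_one _ e (hh.C_mul ha) h1 μ X hmeas hindep hfin
    (by simpa only [HypPoly.closedCone, HypPoly.lambdaMin, hev] using hcone)
    (by simpa only [HypPoly.rank, hev] using hrank) hsum ε
    (by simpa only [HypPoly.trace, hev] using htrace)
  simpa only [HypPoly.lambdaMax, hev] using this
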